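/- Let $k$ be a field of characteristic zero. For $n\ge 0$ let $R_n=k[x_0,\dots,x_n]$ be the ring of polynomial functions on $V_n=k^{n+1}$. Let the additive group $\mathbb G_a$ of $k$ act on $R_n$ by algebra automorphisms with $a*x_i=\sum_{j=0}^{i}\frac{a^j}{j!}x_{i-j}$ (the basic action). Let $D_n=x_0\frac{\partial}{\partial x_1}+\dots+x_{n-1}\frac{\partial}{\partial x_n}$ be the Weitzenböck derivation and $A_n=\ker D_n$. A *separating set* for $A_n$ is a subset $S\subseteq A_n$ such that, for all $u,v\in V_n$, if $g(u)\ne g(v)$ for some $g\in A_n$, then $g(u)\neq g(v)$ for some $g\in S$. Put $$f_0=x_0,\qquad f_m=\sum_{i=0}^{m-1}(-1)^i x_ix_{2m-i}+\tfrac12(-1)^m x_m^2\quad (1\le m\le \lfloor n/2\rfloor),$$ $$s_0=x_1,\qquad s_m=\sum_{i=0}^{m}(-1)^i\,\tfrac{2m+1-2i}{2}\,x_ix_{2m+1-i}\quad (1\le m\le \lfloor (n-1)/2\rfloor).$$ For $s,a\in R_n$ with $a\neq 0$ let $\nu(a)=\min\{m\ge 0: D_n^{m+1}a=0\}$ and $$\epsilon_s(a)=\sum_{j=0}^{\nu(a)}\frac{(-1)^j}{j!}\,(D_n^{j}a)\,s^j\,(D_ns)^{\nu(a)-j}.$$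 If $4\mid n$, put $p=n/4$ and $\Delta_n=\sum_{i=0}^{n-1}(n-i)(i+1)x_{i+1}\frac{\partial}{\partial x_i}$, let $q=\sum_{i=0}^{p-1}(-1)^ix_ix_{2p-i}+\frac12(-1)^px_p^2$, and define $$w=\frac1c\sum_{i=0}^{n}(-1)^i\frac{n!^2\,(n-i)!}{i!}\,x_{n-i}\,\Delta_n^i(q),\qquad c=\frac{n!^2\,((2p)!)^2}{2}\,(-1)^p\frac{(3p)!}{(p!)^3}.$$ Let $E_n$ be the set consisting of * $f_0,\dots,f_{\lfloor n/2\rfloor}$; * $\epsilon_{s_0}(x_2),\dots,\epsilon_{s_0}(x_n)$; * $\epsilon_{s_m}(x_m),\dots,\epsilon_{s_m}(x_n)$ for each $1\le m\le\lfloor (n-1)/2\rfloor$; * if $4\mid n$, also $w$. Then: 1. $A_n$ is the algebra of invariants of the basic action: $g\in A_n$ if and only if $a*g=g$ for all $a\in k$. 2. If $n\ge1$ and $0\le m\le\lfloor (n-1)/2\rfloor$, then $s_m$ is a local slice, that is, $D_ns_m\in A_n\setminus\{0\}$; in fact $D_ns_m=f_m$. 3. If $4\mid n$, then $w\in A_n$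 and $\pi(w)=x_0^3$, where $\pi:R_n\to R_{n/2}$ is the algebra homomorphism $g(x_0,\dots,x_n)\mapsto g(0,\dots,0,x_0,\dots,x_{n/2})$ with $n/2$ zeros. 4. For every $n\ge 0$, the set $E_n$ is a finite separating set for $A_n$. It has exactly $$\Big(\lfloor n/2\rfloor+1\Big)+\max(n-1,0)+\sum_{m=1}^{\lfloor (n-1)/2\rfloor}(n+1-m)+\delta_n$$ elements, where $\delta_n=1$ if $4\mid n$ and $\delta_n=0$ otherwise (the sum is empty for $n\le 2$). The same holds if, when $4\mid n$, $w$ is replaced by any invariant $w'\in A_n$ with $\pi(w')=x_0^3$. 5. $|E_n|/n^2\to 3/8$ as $n\to\infty$. 6. If $n\ge1$, every element of $E_n$ has degree at most $2n+1$. -/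

import Mathlib

open MvPolynomial

universe u

noncomputable section

namespace BasicGa

variable (k : Type u) [Field k]

/-- The polynomial ring `R_n = k[x_0, …, x_n] = k[V_n]`, where `V_n = k^{n+1}`. -/
abbrev R (n : ℕ) : Type u := MvPolynomial (Fin (n + 1)) k

/-- The coordinate function `x_i` of `R_n` for `i ≤ n`
(indexed by a natural number; the value for `i > n` is irrelevant and set to `0`). -/
def x (n i : ℕ) : R k n := if h : i < n + 1 then X ⟨i, h⟩ else 0

/-- The action of `a ∈ 𝔾ₐ` on `R_n` by algebra endomorphisms determined by the basic action
`a * x_i = ∑_{j=0}^{i} (a^j / j!) x_{i-j}` on the linear forms. -/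
def gaAct (n : ℕ) (a : k) : R k n →ₐ[k] R k n :=
  aeval fun i : Fin (n + 1) =>
    ∑ j ∈ Finset.range ((i : ℕ) + 1), C (a ^ j / (j.factorial : k)) * x k n ((i : ℕ) - j)

/-- The Weitzenböck derivation `D_n = x_0 ∂/∂x_1 + ⋯ + x_{n-1} ∂/∂x_n`. -/
def D (n : ℕ) : Derivation k (R k n) (R k n) :=
  mkDerivation k fun i : Fin (n + 1) => if (i : ℕ) = 0 then 0 else x k n ((i : ℕ) - 1)

/-- The algebra `A_n = ker D_n`. -/
def A (n : ℕ) : Subalgebra k (R k n) where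
  carrier := {f | D k n f = 0}
  mul_mem' {f g} hf hg := by
    simp only [Set.mem_ofPred_eq] at hf hg ⊢
    simp [Derivation.leibniz, hf, hg]
  add_mem' {f g} hf hg := by
    simp only [Set.mem_ofPred_eq] at hf hg ⊢
    simp [hf, hg]
  algebraMap_mem' r := by simp

variable {k}

/-- `S ⊆ A_n` is a separating set for `A_n`: whenever two points of `V_n = k^{n+1}` are
distinguished by some element of `A_n`, they are distinguished by some element of `S`. -/
def IsSeparatingSet {n : ℕ} (S : Set (R k n)) : Prop :=
  S ⊆ (A k n : Set (R k n)) ∧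
    ∀ v w : Fin (n + 1) → k,
      (∃ f ∈ A k n, eval v f ≠ eval w f) → ∃ s ∈ S, eval v s ≠ eval w s

/-- `s` is a local slice: `D_n s ∈ A_n \ {0}`. -/
def IsLocalSlice {n : ℕ} (s : R k n) : Prop := D k n s ∈ A k n ∧ D k n s ≠ 0

/-- The nilpotency index `ν(a) = min {m : D_n^{m+1} a = 0}` of `a ≠ 0`. -/
def nu {n : ℕ} (a : R k n) : ℕ := sInf {m : ℕ | (D k n)^[m + 1] a = 0}

/-- `ε_s(a) = ∑_{j=0}^{ν(a)} ((-1)^j / j!) (D_n^j a) s^j (D_n s)^{ν(a)-j}`. -/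
def eps {n : ℕ} (s a : R k n) : R k n :=
  ∑ j ∈ Finset.range (nu a + 1),
    C ((-1) ^ j / (j.factorial : k)) * (D k n)^[j] a * s ^ j * (D k n s) ^ (nu a - j)

variable (k)

/-- The sum `∑_{i=0}^{m-1} (-1)^i x_i x_{2m-i} + (1/2) (-1)^m x_m^2`. -/
def quad (n m : ℕ) : R k n :=
  ∑ i ∈ Finset.range m, (-1) ^ i * x k n i * x k n (2 * m - i)
    + C (1 / 2) * (-1) ^ m * x k n m ^ 2

/-- The invariants `f_0 = x_0` and, for `1 ≤ m ≤ ⌊n/2⌋`,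
`f_m = ∑_{i=0}^{m-1} (-1)^i x_i x_{2m-i} + (1/2) (-1)^m x_m^2`. -/
def f (n m : ℕ) : R k n := if m = 0 then x k n 0 else quad k n m

/-- The local slices `s_0 = x_1` and, for `1 ≤ m ≤ ⌊(n-1)/2⌋`,
`s_m = ∑_{i=0}^{m} (-1)^i ((2m+1-2i)/2) x_i x_{2m+1-i}`. -/
def s (n m : ℕ) : R k n :=
  if m = 0 then x k n 1
  else ∑ i ∈ Finset.range (m + 1),
    (-1) ^ i * C ((2 * (m : k) + 1 - 2 * (i : k)) / 2) * x k n i * x k n (2 * m + 1 - i)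

/-- For `m ≤ n`, the algebra homomorphism `π_{m,n} : R_n → R_m`,
`f(x_0, …, x_n) ↦ f(0, …, 0, x_0, …, x_m)` (with `n - m` zeros). -/
def proj (m n : ℕ) : R k n →ₐ[k] R k m :=
  aeval fun i : Fin (n + 1) => if (i : ℕ) < n - m then 0 else x k m ((i : ℕ) - (n - m))

variable {k} in
/-- For `n = 2m` divisible by `4`: `w` is an invariant satisfying `π_{m,n}(w) = x_0^3`. -/
def IsExtraInvariant {n : ℕ} (w : R k n) : Prop :=
  w ∈ A k n ∧ proj k (n / 2) n w = x k (n / 2) 0 ^ 3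

/-- The derivation `Δ_n = ∑_{i=0}^{n} (n-i)(i+1) x_{i+1} ∂/∂x_i`. -/
def Delta (n : ℕ) : Derivation k (R k n) (R k n) :=
  mkDerivation k fun i : Fin (n + 1) =>
    C ((n : k) - ((i : ℕ) : k)) * C (((i : ℕ) : k) + 1) * x k n ((i : ℕ) + 1)

/-- For `n = 4p`, the `n`-th semitransvectant of `x_0` and
`f = ∑_{i=0}^{p-1} (-1)^i x_i x_{2p-i} + (1/2) (-1)^p x_p^2`:
`∑_{i=0}^{n} (-1)^i (n!^2 (n-i)! / i!) x_{n-i} Δ_n^i(f)`. -/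
def wBar (n : ℕ) : R k n :=
  ∑ i ∈ Finset.range (n + 1),
    C ((-1) ^ i * ((n.factorial : k) ^ 2 * ((n - i).factorial : k) / (i.factorial : k)))
      * x k n (n - i) * (Delta k n)^[i] (quad k n (n / 4))

/-- For `n = 4p`, the factor by which `π_{n/2,n}` of the semitransvectant above differs
from `x_0^3`. -/
def wFactor (n : ℕ) : k :=
  (n.factorial : k) ^ 2 * ((n / 2).factorial : k) ^ 2 / 2 *
    ((-1) ^ (n / 4) * ((3 * (n / 4)).factorial : k) / ((n / 4).factorial : k) ^ 3)

/-- The explicit extra invariant `w`, used when `4 ∣ n`: the semitransvectant above, scaled so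
that `π_{n/2,n}(w) = x_0^3`. -/
def wInv (n : ℕ) : R k n := C (wFactor k n)⁻¹ * wBar k n

variable {k} in
/-- The set consisting of `f_0, …, f_⌊n/2⌋`, of `ε_{s_0}(x_2), …, ε_{s_0}(x_n)`, of
`ε_{s_m}(x_m), …, ε_{s_m}(x_n)` for `1 ≤ m ≤ ⌊(n-1)/2⌋` and, only if `4 ∣ n`, of `w`. -/
def E (n : ℕ) (w : R k n) : Set (R k n) :=
  {g | ∃ m, m ≤ n / 2 ∧ g = f k n m}
    ∪ {g | ∃ j, 2 ≤ j ∧ j ≤ n ∧ g = eps (s k n 0) (x k n j)}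
    ∪ {g | ∃ m j, 1 ≤ m ∧ m ≤ (n - 1) / 2 ∧ m ≤ j ∧ j ≤ n ∧ g = eps (s k n m) (x k n j)}
    ∪ {g | 4 ∣ n ∧ g = w}

end BasicGa

end

namespace BasicGa

/-! ### Coordinates, and the values of D and Δ on them -/

variable {k : Type u} [Field k]

/-! Suppose u and v agree on `E_n`. Where x_0 = … = x_{m-1} = 0, the invariant f_m reduces to
±x_m²/2 (to x_0 if m = 0). Hence the first m with 2m < n and f_m ≠ 0, if any, is the same for u and
v, and both have zero coordinates below m. Since D s_m = f_m, the value of ε_{s_m}(x_j) is then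
f_m^j times the j-th coordinate of the point of the orbit at which s_m = 0 (`eval_eps_x`). Equal
values put u and v in one orbit (`eval_eq_of_eps_eq`).

If there is no such m, all coordinates of index below n/2 vanish, and sl₂ enters. D raises the torus
weight n - 2i by 2, Δ lowers it by 2, and [D, Δ] is the weight. So elements of ker D contain only
monomials of non-negative weight (`weight_nonneg_of_mem_support`), and at such points an invariant
sees only the middle coordinate c (`eval_eq_eval_weight_zero`). For odd n there is none. For n = 2l,
f_l determines c². If l is odd, the Weyl element sends c to -c, so invariants are even in c
(`eval_mid_neg`). If l is even, w restricts to c³, and c² and c³ determine c.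

The semitransvectant defining w is killed by D, and it restricts to a multiple of c³ whose factor is
evaluated by Dixon's identity (`dixon_sum`) and is nonzero. The group actions are handled through
polynomial integral curves (`eval_eq_of_curve`). The count rests on degrees and on evaluation at a
few test points. -/

/-- The coordinate `u_i` of a point, set to `0` for `i > n`. -/
noncomputable def coord {n : ℕ} (u : Fin (n + 1) → k) (i : ℕ) : k :=
  if h : i < n + 1 then u ⟨i, h⟩ else 0

theorem coord_val {n : ℕ} (u : Fin (n + 1) → k) (i : Fin (n + 1)) : coord u i = u i := by
  rw [coord, dif_pos i.is_lt]

@[simp]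
theorem eval_x {n : ℕ} (u : Fin (n + 1) → k) (i : ℕ) : eval u (x k n i) = coord u i := by
  unfold x coord
  split_ifs <;> simp

theorem x_val {n : ℕ} (i : Fin (n + 1)) : x k n i = X i := by
  rw [x, dif_pos i.is_lt]

theorem x_of_gt {n i : ℕ} (h : n < i) : x k n i = 0 := by
  simp [x, show ¬ i < n + 1 by omega]

theorem x_ne_zero {n i : ℕ} (h : i ≤ n) : x k n i ≠ 0 := by
  simp [x, show i < n + 1 by omega]

theorem D_X {n : ℕ} (i : Fin (n + 1)) :
    D k n (X i) = if (i : ℕ) = 0 then 0 else x k n ((i : ℕ) - 1) := by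
  simp [D]

@[simp]
theorem D_x_zero (n : ℕ) : D k n (x k n 0) = 0 := by
  simp [x, D_X]

theorem D_x_succ {n i : ℕ} (h : i + 1 ≤ n) : D k n (x k n (i + 1)) = x k n i := by
  have : x k n (i + 1) = X ⟨i + 1, by omega⟩ := by simp [x, h]
  rw [this, D_X]
  simp

theorem D_iterate_x {n i : ℕ} (h : i ≤ n) (j : ℕ) :
    (D k n)^[j] (x k n i) = if j ≤ i then x k n (i - j) else 0 := by
  induction j with
  | zero => simp
  | succ j ih =>
    rw [Function.iterate_succ_apply', ih]
    rcases lt_trichotomy j i with h1 | h1 | h1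
    · obtain ⟨a, ha⟩ : ∃ a, i - j = a + 1 := ⟨i - j - 1, by omega⟩
      rw [if_pos h1.le, if_pos (by omega), ha, D_x_succ (by omega)]
      congr 1
      omega
    · subst h1
      simp
    · rw [if_neg (by omega), if_neg (by omega), map_zero]

theorem nu_x {n i : ℕ} (h : i ≤ n) : nu (x k n i) = i := by
  unfold nu
  apply le_antisymm
  · apply Nat.sInf_le
    simp [-Function.iterate_succ, D_iterate_x h]
  · apply le_csInf ⟨i, by simp [-Function.iterate_succ, D_iterate_x h]⟩
    intro m hm
    by_contra hlt
    simp only [Set.mem_ofPred_eq, D_iterate_x h, if_pos (show m + 1 ≤ i by omega)] at hm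
    exact x_ne_zero (by omega) hm

theorem Delta_X {n : ℕ} (i : Fin (n + 1)) :
    Delta k n (X i) = C ((n : k) - ((i : ℕ) : k)) * C (((i : ℕ) : k) + 1) * x k n ((i : ℕ) + 1) := by
  simp [Delta]

theorem Delta_x {n i : ℕ} :
    Delta k n (x k n i) = C ((n : k) - (i : k)) * C ((i : k) + 1) * x k n (i + 1) := by
  by_cases h : i < n + 1
  · have : x k n i = X ⟨i, h⟩ := by simp [x, h]
    rw [this, Delta_X]
  · rw [x_of_gt (by omega), x_of_gt (by omega)]
    simp

theorem mem_A {n : ℕ} {g : R k n} : g ∈ A k n ↔ D k n g = 0 := Iff.rfl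

/-! ### Integral curves of derivations -/

/-- Both sides obey the Leibniz rule along γ, so the generators decide. The hypothesis says that γ
is an integral curve of δ, which stands in for exponentiating δ. -/
theorem derivative_algHom {n : ℕ} (δ : Derivation k (R k n) (R k n))
    (γ : R k n →ₐ[k] Polynomial k)
    (h : ∀ i, Polynomial.derivative (γ (X i)) = γ (δ (X i))) (g : R k n) :
    Polynomial.derivative (γ g) = γ (δ g) := by
  induction g using MvPolynomial.induction_on with
  | C a =>
    rw [derivation_C, map_zero, ← MvPolynomial.algebraMap_eq, AlgHom.commutes,
      Polynomial.algebraMap_eq, Polynomial.derivative_C]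
  | add p q hp hq => simp [hp, hq]
  | mul_X p i hp =>
    simp only [map_mul, Polynomial.derivative_mul, hp, h, Derivation.leibniz, smul_eq_mul, map_add]
    ring

theorem iterate_derivative_algHom {n : ℕ} (δ : Derivation k (R k n) (R k n))
    (γ : R k n →ₐ[k] Polynomial k)
    (h : ∀ i, Polynomial.derivative (γ (X i)) = γ (δ (X i))) (g : R k n) (j : ℕ) :
    Polynomial.derivative^[j] (γ g) = γ (δ^[j] g) := by
  induction j with
  | zero => rfl
  | succ j ih => rw [Function.iterate_succ_apply', Function.iterate_succ_apply', ih,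
      derivative_algHom δ γ h]

theorem eval_algHom {n : ℕ} (γ : R k n →ₐ[k] Polynomial k) (a : k) (g : R k n) :
    (γ g).eval a = eval (fun i => (γ (X i)).eval a) g := by
  have : (Polynomial.aeval a : Polynomial k →ₐ[k] k).comp γ =
      aeval (fun i => (γ (X i)).eval a) := by
    apply MvPolynomial.algHom_ext
    intro i
    simp
  have h2 := DFunLike.congr_fun this g
  simpa [Polynomial.aeval_def, Polynomial.eval₂_eq_eval_map, MvPolynomial.aeval_eq_eval] using h2

/-- An element of ker δ has zero derivative along an integral curve, hence is constant on it in
characteristic zero. -/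
theorem eval_eq_of_curve [CharZero k] {n : ℕ} (δ : Derivation k (R k n) (R k n))
    (γ : R k n →ₐ[k] Polynomial k)
    (h : ∀ i, Polynomial.derivative (γ (X i)) = γ (δ (X i))) {g : R k n} (hg : δ g = 0)
    (a b : k) :
    eval (fun i => (γ (X i)).eval a) g = eval (fun i => (γ (X i)).eval b) g := by
  have h1 := derivative_algHom δ γ h g
  rw [hg, map_zero] at h1
  rw [← eval_algHom, ← eval_algHom, Polynomial.eq_C_of_derivative_eq_zero h1]
  simp

/-! ### The flow of `D` -/

/-- The point obtained from `u` by the basic action of `a`. -/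
noncomputable def flow {n : ℕ} (a : k) (u : Fin (n + 1) → k) : Fin (n + 1) → k := fun i =>
  ∑ j ∈ Finset.range ((i : ℕ) + 1), a ^ j / (j.factorial : k) * coord u ((i : ℕ) - j)

theorem eval_gaAct {n : ℕ} (a : k) (u : Fin (n + 1) → k) (g : R k n) :
    eval u (gaAct k n a g) = eval (flow a u) g := by
  have : (aeval u : R k n →ₐ[k] k).comp (gaAct k n a) = aeval (flow a u) := by
    apply MvPolynomial.algHom_ext
    intro i
    simp [gaAct, flow, MvPolynomial.aeval_eq_eval]
  simpa [MvPolynomial.aeval_eq_eval] using DFunLike.congr_fun this g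

/-- The orbit map `a ↦ flow a u` as a polynomial curve. -/
noncomputable def flowCurve {n : ℕ} (u : Fin (n + 1) → k) : R k n →ₐ[k] Polynomial k :=
  aeval fun i => ∑ j ∈ Finset.range ((i : ℕ) + 1),
    Polynomial.C (coord u ((i : ℕ) - j) / (j.factorial : k)) * Polynomial.X ^ j

theorem eval_flowCurve_X {n : ℕ} (u : Fin (n + 1) → k) (a : k) (i : Fin (n + 1)) :
    (flowCurve u (X i)).eval a = flow a u i := by
  simp only [flowCurve, flow, aeval_X, Polynomial.eval_finsetSum, Polynomial.eval_mul,
    Polynomial.eval_C, Polynomial.eval_pow, Polynomial.eval_X]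
  exact Finset.sum_congr rfl fun j _ => by ring

theorem flow_zero {n : ℕ} (u : Fin (n + 1) → k) : flow 0 u = u := by
  funext i
  rw [flow, Finset.sum_range_succ', Finset.sum_eq_zero (fun j _ => by simp)]
  simp [coord_val]

theorem derivative_flowCurve_X [CharZero k] {n : ℕ} (u : Fin (n + 1) → k) (i : Fin (n + 1)) :
    Polynomial.derivative (flowCurve u (X i)) = flowCurve u (D k n (X i)) := by
  obtain ⟨i, hi⟩ := i
  rw [D_X]
  cases i with
  | zero => simp [flowCurve]
  | succ i =>
    have : x k n i = X ⟨i, by omega⟩ := by simp [x, show i < n + 1 by omega]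
    simp only [Nat.add_eq_zero_iff, one_ne_zero, and_false, if_false, Nat.add_sub_cancel, this,
      flowCurve, aeval_X, Polynomial.derivative_sum]
    rw [Finset.sum_range_succ']
    simp only [Polynomial.derivative_C_mul_X_pow, Nat.factorial_succ, pow_zero, mul_one,
      Polynomial.derivative_C, add_zero, Nat.add_sub_cancel, Nat.add_sub_add_right]
    refine Finset.sum_congr rfl fun j _ => ?_
    congr 2
    have := Nat.cast_add_one_ne_zero (R := k) j
    have := Nat.factorial_ne_zero j
    push_cast
    field_simp

theorem eval_flow [CharZero k] {n : ℕ} {g : R k n} (hg : g ∈ A k n) (a : k)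
    (u : Fin (n + 1) → k) : eval (flow a u) g = eval u g := by
  have h := eval_eq_of_curve (D k n) (flowCurve u) (derivative_flowCurve_X u) hg a 0
  simpa only [eval_flowCurve_X, flow_zero] using h

theorem mem_A_iff_forall_gaAct [CharZero k] {n : ℕ} (g : R k n) :
    g ∈ A k n ↔ ∀ a : k, gaAct k n a g = g := by
  constructor
  · intro hg a
    apply MvPolynomial.funext
    intro u
    rw [eval_gaAct, eval_flow hg]
  · intro h
    apply MvPolynomial.funext
    intro u
    -- k is infinite, so a polynomial in a with constant values is constant; differentiating it at a
    -- = 0 gives (D g)(u) = 0.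
    have h1 : flowCurve u g = Polynomial.C (eval u g) := by
      apply Polynomial.funext
      intro a
      rw [eval_algHom]
      simp only [eval_flowCurve_X, Polynomial.eval_C]
      rw [← eval_gaAct, h]
    have h2 := derivative_algHom _ _ (derivative_flowCurve_X u) g
    rw [h1, Polynomial.derivative_C] at h2
    have h3 := eval_algHom (flowCurve u) 0 (D k n g)
    rw [← h2] at h3
    simp only [eval_flowCurve_X, flow_zero] at h3
    simpa using h3.symm

/-! ### Locally nilpotent derivations -/

theorem Derivation.map_C_mul {σ : Type*} (δ : Derivation k (MvPolynomial σ k) (MvPolynomial σ k))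
    (a : k) (g : MvPolynomial σ k) : δ (C a * g) = C a * δ g := by
  rw [← smul_eq_C_mul, Derivation.map_smul, smul_eq_C_mul]

theorem Derivation.iterate_eq_zero_of_le {B : Type*} [CommRing B] [Algebra k B]
    (δ : Derivation k B B) {g : B} {N M : ℕ} (hg : δ^[N] g = 0) (h : N ≤ M) : δ^[M] g = 0 := by
  obtain ⟨c, rfl⟩ := Nat.exists_eq_add_of_le' h
  rw [Function.iterate_add_apply, hg, iterate_map_zero]

/-- Leibniz spends one derivative on either factor, so induction on N + M applies. This makes local
nilpotence a matter of generators. -/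
theorem Derivation.iterate_mul_eq_zero {B : Type*} [CommRing B] [Algebra k B]
    (δ : Derivation k B B) : ∀ (S N M : ℕ) (g h : B), N + M = S → δ^[N] g = 0 → δ^[M] h = 0 →
      δ^[S] (g * h) = 0 := by
  intro S
  induction S with
  | zero =>
    intro N M g h hS hg hh
    obtain ⟨rfl, rfl⟩ : N = 0 ∧ M = 0 := by omega
    simp only [Function.iterate_zero, id] at hg ⊢
    simp [hg]
  | succ S ih =>
    intro N M g h hS hg hh
    rcases Nat.eq_zero_or_pos N with rfl | hN
    · simp only [Function.iterate_zero, id] at hg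
      rw [hg, zero_mul, iterate_map_zero]
    rcases Nat.eq_zero_or_pos M with rfl | hM
    · simp only [Function.iterate_zero, id] at hh
      rw [hh, mul_zero, iterate_map_zero]
    obtain ⟨N, rfl⟩ := Nat.exists_eq_add_of_lt hN
    obtain ⟨M, rfl⟩ := Nat.exists_eq_add_of_lt hM
    simp only [zero_add] at hg hh
    rw [Function.iterate_succ_apply, Derivation.leibniz, smul_eq_mul, smul_eq_mul,
      iterate_map_add, ih (0 + N + 1) M g (δ h) (by omega) (by simpa using hg) (by simpa using hh),
      mul_comm, ih N (0 + M + 1) (δ g) h (by omega) (by simpa using hg) (by simpa using hh),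
      add_zero]

theorem Derivation.exists_iterate_eq_zero {σ : Type*}
    (δ : Derivation k (MvPolynomial σ k) (MvPolynomial σ k))
    (h : ∀ i, ∃ N : ℕ, δ^[N] (X i) = 0) (g : MvPolynomial σ k) : ∃ N : ℕ, δ^[N] g = 0 := by
  induction g using MvPolynomial.induction_on with
  | C a => exact ⟨1, by simp⟩
  | add p q hp hq =>
    obtain ⟨N, hN⟩ := hp
    obtain ⟨M, hM⟩ := hq
    exact ⟨N + M, by rw [iterate_map_add, iterate_eq_zero_of_le δ hN (by omega),
      iterate_eq_zero_of_le δ hM (by omega), add_zero]⟩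
  | mul_X p i hp =>
    obtain ⟨N, hN⟩ := hp
    obtain ⟨M, hM⟩ := h i
    exact ⟨N + M, iterate_mul_eq_zero δ _ N M p _ rfl hN hM⟩

theorem exists_Delta_iterate_x {n : ℕ} (i j : ℕ) :
    ∃ c : k, (Delta k n)^[j] (x k n i) = C c * x k n (i + j) := by
  induction j with
  | zero => exact ⟨1, by simp⟩
  | succ j ih =>
    obtain ⟨c, hc⟩ := ih
    refine ⟨c * (((n : k) - ((i + j : ℕ) : k)) * (((i + j : ℕ) : k) + 1)), ?_⟩
    rw [Function.iterate_succ_apply', hc, Derivation.map_C_mul, Delta_x]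
    simp only [C_mul, add_assoc]
    ring

theorem exists_Delta_iterate_eq_zero {n : ℕ} (g : R k n) : ∃ N : ℕ, (Delta k n)^[N] g = 0 := by
  refine Derivation.exists_iterate_eq_zero _ (fun i => ⟨n + 1, ?_⟩) g
  obtain ⟨c, hc⟩ := exists_Delta_iterate_x (k := k) (n := n) i (n + 1)
  rw [← x_val, hc, x_of_gt (by omega), mul_zero]

/-! ### Derivations and weights -/

/-- By Leibniz the shift by d is decided on the variables. The grading monoid is arbitrary so that
this serves both the torus weights and, with d = 0, the ordinary degree. -/
theorem isWeightedHomogeneous_derivation {σ M : Type*} [AddCommMonoid M] {w : σ → M} {d : M}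
    (δ : Derivation k (MvPolynomial σ k) (MvPolynomial σ k))
    (h : ∀ i, (δ (X i)).IsWeightedHomogeneous w (w i + d)) {g : MvPolynomial σ k} {μ : M}
    (hg : g.IsWeightedHomogeneous w μ) : (δ g).IsWeightedHomogeneous w (μ + d) := by
  have key : ∀ (s : σ →₀ ℕ),
      (δ (monomial s 1)).IsWeightedHomogeneous w (Finsupp.weight w s + d) := by
    intro s
    induction s using Finsupp.induction_linear with
    | zero =>
      rw [← MvPolynomial.C_apply, derivation_C]
      exact isWeightedHomogeneous_zero k w _
    | add s t hs ht =>
      have e : (monomial (s + t) (1 : k)) = monomial s 1 * monomial t 1 := by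
        simp [monomial_mul]
      rw [e, Derivation.leibniz, smul_eq_mul, smul_eq_mul, map_add]
      have h1 := (isWeightedHomogeneous_monomial w s (1 : k) rfl).mul ht
      have h2 := (isWeightedHomogeneous_monomial w t (1 : k) rfl).mul hs
      rw [← add_assoc] at h1
      rw [← add_assoc, add_comm (Finsupp.weight w t)] at h2
      exact h1.add h2
    | single i a =>
      rw [← X_pow_eq_monomial, Derivation.leibniz_pow, smul_eq_mul]
      cases a with
      | zero =>
        rw [zero_smul]
        exact isWeightedHomogeneous_zero k w _
      | succ a =>
        have h1 := ((isWeightedHomogeneous_X k w i).pow a).mul (h i)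
        rw [Finsupp.weight_single, succ_nsmul (w i), add_assoc]
        exact Submodule.smul_of_tower_mem (weightedHomogeneousSubmodule k w _) _ h1
  refine IsWeightedHomogeneous.induction_on (motive := fun p _ =>
    (δ p).IsWeightedHomogeneous w (μ + d)) ?_ ?_ ?_ hg
  · rw [map_zero]
    exact isWeightedHomogeneous_zero k w _
  · intro p q _ _ hp hq
    rw [map_add]
    exact hp.add hq
  · intro s r hs
    have e : monomial s r = C r * monomial s 1 := by simp [C_mul_monomial]
    rw [e, Derivation.map_C_mul, ← hs]
    exact (key s).C_mul r

theorem derivation_weightedHomogeneousComponent {σ M : Type*} [AddCancelCommMonoid M] {w : σ → M}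
    {d : M} (δ : Derivation k (MvPolynomial σ k) (MvPolynomial σ k))
    (h : ∀ i, (δ (X i)).IsWeightedHomogeneous w (w i + d)) (g : MvPolynomial σ k) (μ : M) :
    δ (weightedHomogeneousComponent w μ g) = weightedHomogeneousComponent w (μ + d) (δ g) := by
  classical
  induction g using MvPolynomial.induction_on' with
  | monomial s r =>
    have h1 := isWeightedHomogeneous_monomial w s r rfl
    have h2 := isWeightedHomogeneous_derivation δ h h1
    rw [weightedHomogeneousComponent_of_mem h1, weightedHomogeneousComponent_of_mem h2]
    by_cases e : μ = Finsupp.weight w s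
    · simp [e]
    · rw [if_neg e, if_neg (fun h => e (add_right_cancel h)), map_zero]
  | add p q hp hq => simp only [map_add, hp, hq]

/-- The weights of the coordinate functions for the diagonal torus of `SL₂`. -/
def wt (n : ℕ) (i : Fin (n + 1)) : ℤ := n - 2 * (i : ℕ)

theorem isWeightedHomogeneous_x {n i : ℕ} :
    (x k n i).IsWeightedHomogeneous (wt n) (n - 2 * i) := by
  unfold x
  split_ifs with h
  · exact isWeightedHomogeneous_X k (wt n) _
  · exact isWeightedHomogeneous_zero k _ _

theorem isWeightedHomogeneous_D_X {n : ℕ} (i : Fin (n + 1)) :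
    (D k n (X i)).IsWeightedHomogeneous (wt n) (wt n i + 2) := by
  rw [D_X]
  split_ifs with h
  · exact isWeightedHomogeneous_zero k _ _
  · have := isWeightedHomogeneous_x (k := k) (n := n) (i := (i : ℕ) - 1)
    convert this using 1
    unfold wt
    omega

/-- The commutator is again a derivation, and on x_i it multiplies by (n-i)(i+1) - (n-i+1)i = n -
2i, the weight; on monomials the weights add up. -/
theorem lie_D_Delta {n : ℕ} {g : R k n} {μ : ℤ} (hg : g.IsWeightedHomogeneous (wt n) μ) :
    D k n (Delta k n g) - Delta k n (D k n g) = C (μ : k) * g := by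
  have hX : ∀ i, ⁅D k n, Delta k n⁆ (X i) = C ((wt n i : ℤ) : k) * X i := by
    intro i
    obtain ⟨i, hi⟩ := i
    have e : (X ⟨i, hi⟩ : R k n) = x k n i := by simp [x, hi]
    rw [Derivation.commutator_apply, e, Delta_x, ← C_mul, Derivation.map_C_mul]
    have h1 : C (((n : k) - i) * (i + 1)) * D k n (x k n (i + 1)) =
        C (((n : k) - i) * (i + 1)) * x k n i := by
      rcases Nat.lt_or_ge i n with h | h
      · rw [D_x_succ h]
      · obtain rfl : i = n := by omega
        simp
    rw [h1]
    cases i with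
    | zero => simp [wt]
    | succ i =>
      rw [D_x_succ (by omega), Delta_x, ← C_mul, ← sub_mul, ← C_sub]
      congr 2
      simp only [wt]
      push_cast
      ring
  rw [← Derivation.commutator_apply]
  have key : ∀ (s : Fin (n + 1) →₀ ℕ), ⁅D k n, Delta k n⁆ (monomial s 1) =
      C ((Finsupp.weight (wt n) s : ℤ) : k) * monomial s 1 := by
    intro s
    induction s using Finsupp.induction_linear with
    | zero =>
      rw [← MvPolynomial.C_apply, derivation_C]
      simp
    | add s t hs ht =>
      have e : (monomial (s + t) (1 : k)) = monomial s 1 * monomial t 1 := by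
        simp [monomial_mul]
      rw [e, Derivation.leibniz, smul_eq_mul, smul_eq_mul, map_add, hs, ht]
      push_cast
      rw [C_add]
      ring
    | single i a =>
      rw [← X_pow_eq_monomial, Derivation.leibniz_pow, smul_eq_mul, hX, Finsupp.weight_single]
      cases a with
      | zero => simp
      | succ a =>
        simp only [Nat.add_sub_cancel, nsmul_eq_mul, Int.cast_mul, Int.cast_natCast, C_mul, pow_succ]
        rw [map_natCast]
        ring
  refine IsWeightedHomogeneous.induction_on (motive := fun p _ =>
    ⁅D k n, Delta k n⁆ p = C (μ : k) * p) ?_ ?_ ?_ hg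
  · simp
  · intro p q _ _ hp hq
    rw [map_add, hp, hq, mul_add]
  · intro s r hs
    have e : monomial s r = C r * monomial s 1 := by simp [C_mul_monomial]
    rw [e, Derivation.map_C_mul, key, hs]
    ring

theorem isWeightedHomogeneous_Delta_X {n : ℕ} (i : Fin (n + 1)) :
    (Delta k n (X i)).IsWeightedHomogeneous (wt n) (wt n i + (-2)) := by
  rw [Delta_X, ← C_mul]
  convert (isWeightedHomogeneous_x (k := k) (n := n) (i := (i : ℕ) + 1)).C_mul _ using 1
  unfold wt
  push_cast
  ring

theorem isWeightedHomogeneous_Delta_iterate {n : ℕ} {g : R k n} {μ : ℤ}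
    (hg : g.IsWeightedHomogeneous (wt n) μ) (j : ℕ) :
    ((Delta k n)^[j] g).IsWeightedHomogeneous (wt n) (μ - 2 * j) := by
  induction j with
  | zero => simpa using hg
  | succ j ih =>
    rw [Function.iterate_succ_apply']
    convert isWeightedHomogeneous_derivation _ isWeightedHomogeneous_Delta_X ih using 1
    push_cast
    ring

/-- The sl₂ ladder: moving D past each Δ contributes the current weight, and ∑_{i≤j} (μ - 2i) =
(j+1)(μ - j). -/
theorem D_Delta_iterate {n : ℕ} {g : R k n} {μ : ℤ} (hg : g.IsWeightedHomogeneous (wt n) μ)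
    (hD : D k n g = 0) (j : ℕ) :
    D k n ((Delta k n)^[j + 1] g) = C (((j : k) + 1) * (μ - j)) * (Delta k n)^[j] g := by
  induction j with
  | zero =>
    have := lie_D_Delta hg
    rw [hD, map_zero, sub_zero] at this
    simpa using this
  | succ j ih =>
    have := lie_D_Delta (isWeightedHomogeneous_Delta_iterate hg (j + 1))
    rw [← Function.iterate_succ_apply' (Delta k n), ih, Derivation.map_C_mul,
      ← Function.iterate_succ_apply' (Delta k n), sub_eq_iff_eq_add, ← add_mul, ← C_add] at this
    rw [this]
    congr 2
    push_cast
    ring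

/-- A nonzero weight vector killed by `D` has nonnegative weight, and if its weight is zero it is
also killed by `Δ`. -/
theorem weight_nonneg_of_D_eq_zero [CharZero k] {n : ℕ} {g : R k n} {μ : ℤ}
    (hg : g.IsWeightedHomogeneous (wt n) μ) (hD : D k n g = 0) (h0 : g ≠ 0) :
    0 ≤ μ ∧ (μ = 0 → Delta k n g = 0) := by
  classical
  have hex := exists_Delta_iterate_eq_zero g
  -- Δ^N g is the last nonzero rung; applying D to Δ^{N+1} g = 0 forces μ = N.
  obtain ⟨N, hN⟩ : ∃ N, Nat.find hex = N + 1 := by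
    refine Nat.exists_eq_succ_of_ne_zero fun h => h0 ?_
    simpa [h] using Nat.find_spec hex
  have h1 := Nat.find_spec hex
  have h2 := Nat.find_min hex (m := N) (by omega)
  have h3 := D_Delta_iterate hg hD N
  rw [hN] at h1
  rw [h1, map_zero] at h3
  have h4 : (μ : k) - N = 0 := by
    have h5 : ((N : k) + 1) * (μ - N) = 0 := by
      rw [← C_eq_zero (σ := Fin (n + 1))]
      exact (mul_eq_zero.1 h3.symm).resolve_right h2
    exact (mul_eq_zero.1 h5).resolve_left (Nat.cast_add_one_ne_zero N)
  have h5 : μ = N := by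
    rw [sub_eq_zero] at h4
    exact_mod_cast h4
  refine ⟨by omega, fun h => ?_⟩
  obtain rfl : N = 0 := by omega
  simpa using h1

theorem weightedHomogeneousComponent_mem_A {n : ℕ} {g : R k n} (hg : g ∈ A k n) (μ : ℤ) :
    weightedHomogeneousComponent (wt n) μ g ∈ A k n := by
  rw [mem_A, derivation_weightedHomogeneousComponent _ isWeightedHomogeneous_D_X, mem_A.1 hg,
    map_zero]

theorem weight_nonneg_of_mem_support [CharZero k] {n : ℕ} {g : R k n} (hg : g ∈ A k n)
    {d : Fin (n + 1) →₀ ℕ} (hd : d ∈ g.support) : 0 ≤ Finsupp.weight (wt n) d := by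
  refine (weight_nonneg_of_D_eq_zero (weightedHomogeneousComponent_isWeightedHomogeneous
    (Finsupp.weight (wt n) d) g) (weightedHomogeneousComponent_mem_A hg _) fun h => ?_).1
  have := congrArg (coeff d) h
  rw [coeff_weightedHomogeneousComponent, if_pos rfl, coeff_zero] at this
  exact mem_support_iff.1 hd this

theorem Delta_weightedHomogeneousComponent_zero [CharZero k] {n : ℕ} {g : R k n}
    (hg : g ∈ A k n) : Delta k n (weightedHomogeneousComponent (wt n) 0 g) = 0 := by
  by_cases h : weightedHomogeneousComponent (wt n) 0 g = 0
  · rw [h, map_zero]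
  · exact (weight_nonneg_of_D_eq_zero (weightedHomogeneousComponent_isWeightedHomogeneous 0 g)
      (weightedHomogeneousComponent_mem_A hg _) h).2 rfl

/-- A monomial of non-negative weight containing a non-middle variable must contain one of positive
weight, and that variable vanishes at u. -/
theorem eval_eq_eval_weight_zero [CharZero k] {n : ℕ} {g : R k n} (hg : g ∈ A k n)
    {u : Fin (n + 1) → k} (hu : ∀ i : Fin (n + 1), 2 * (i : ℕ) < n → u i = 0) :
    eval u g = eval (fun i : Fin (n + 1) => if 2 * (i : ℕ) = n then u i else 0) g := by
  rw [eval_eq, eval_eq]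
  refine Finset.sum_congr rfl fun d hd => ?_
  congr 1
  by_cases h : ∀ i ∈ d.support, 2 * (i : ℕ) = n
  · exact Finset.prod_congr rfl fun i hi => by rw [if_pos (h i hi)]
  · push Not at h
    obtain ⟨i, hi, hin⟩ := h
    obtain ⟨j, hj, hjn⟩ : ∃ j ∈ d.support, 2 * (j : ℕ) < n := by
      by_contra! hcon
      have h1 := weight_nonneg_of_mem_support hg hd
      rw [Finsupp.weight_apply, Finsupp.sum] at h1
      refine absurd h1 (not_le.2 (Finset.sum_neg' (fun j hj => ?_) ⟨i, hi, ?_⟩))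
      · have := hcon j hj
        simp only [wt, nsmul_eq_mul]
        exact mul_nonpos_of_nonneg_of_nonpos (by positivity) (by omega)
      · have := hcon i hi
        simp only [wt, nsmul_eq_mul]
        exact mul_neg_of_pos_of_neg
          (by exact_mod_cast Nat.pos_of_ne_zero (Finsupp.mem_support_iff.1 hi)) (by omega)
    refine (Finset.prod_eq_zero hj ?_).trans (Finset.prod_eq_zero hi ?_).symm
    · rw [hu j hjn, zero_pow (Finsupp.mem_support_iff.1 hj)]
    · rw [if_neg hin, zero_pow (Finsupp.mem_support_iff.1 hi)]

theorem eval_weightedHomogeneousComponent_zero {n : ℕ} (g : R k n)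
    {u : Fin (n + 1) → k} (hu : ∀ i : Fin (n + 1), 2 * (i : ℕ) ≠ n → u i = 0) :
    eval u (weightedHomogeneousComponent (wt n) 0 g) = eval u g := by
  rw [weightedHomogeneousComponent_apply, map_sum, eval_eq u g, Finset.sum_filter]
  refine Finset.sum_congr rfl fun d hd => ?_
  split_ifs with h
  · simp [eval_monomial, Finsupp.prod]
  · obtain ⟨i, hi, hin⟩ : ∃ i ∈ d.support, 2 * (i : ℕ) ≠ n := by
      by_contra! hcon
      refine h ?_
      rw [Finsupp.weight_apply, Finsupp.sum]
      refine Finset.sum_eq_zero fun i hi => ?_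
      have := hcon i hi
      rw [show wt n i = 0 by unfold wt; omega, smul_zero]
    rw [Finset.prod_eq_zero hi (by rw [hu i hin, zero_pow (Finsupp.mem_support_iff.1 hi)]),
      mul_zero]

/-! ### Dixon's identity -/

/-- The N-th finite difference kills polynomials of degree less than N. -/
theorem alternating_sum_choose_mul_eval (P : Polynomial k) {N : ℕ} (hP : P.natDegree < N) :
    ∑ i ∈ Finset.range (N + 1), (-1) ^ i * (N.choose i : k) * P.eval (i : k) = 0 := by
  have h := congrFun (Polynomial.fwdDiff_iter_eq_zero_of_degree_lt hP) 0
  rw [fwdDiff_iter_eq_sum_shift, Pi.zero_apply] at h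
  have h2 : (-1 : k) ^ N * ∑ i ∈ Finset.range (N + 1),
      (-1) ^ i * (N.choose i : k) * P.eval (i : k) = 0 := by
    rw [← h, Finset.mul_sum]
    refine Finset.sum_congr rfl fun i hi => ?_
    obtain ⟨c, rfl⟩ := Nat.exists_eq_add_of_le (Nat.lt_succ_iff.1 (Finset.mem_range.1 hi))
    simp only [Nat.add_sub_cancel_left, zero_add, nsmul_eq_mul, mul_one, zsmul_eq_mul]
    push_cast
    have : ((-1 : k) ^ i) * (-1) ^ i = 1 := by rw [← mul_pow]; simp
    rw [pow_add]
    linear_combination ((-1 : k) ^ c * ((i + c).choose i : k) * P.eval (i : k)) * this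
  simpa using h2

theorem ascPochhammer_eval_natCast_succ [CharZero k] (s i : ℕ) :
    (ascPochhammer k i).eval ((s : k) + 1) = ((s + i).factorial : k) / s.factorial := by
  rw [eq_div_iff (by exact_mod_cast s.factorial_ne_zero)]
  have := ascPochhammer_nat_eq_natCast_ascFactorial k (s + 1) i
  push_cast at this
  rw [this, ← Nat.factorial_mul_ascFactorial]
  push_cast
  ring

theorem ascPochhammer_eval_neg_natCast [CharZero k] {m i : ℕ} (h : i ≤ m) :
    (ascPochhammer k i).eval (-(m : k)) = (-1) ^ i * (m.factorial : k) / (m - i).factorial := by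
  rw [ascPochhammer_eval_neg_eq_descPochhammer, descPochhammer_eval_eq_descFactorial,
    eq_div_iff (by exact_mod_cast (m - i).factorial_ne_zero),
    ← Nat.factorial_mul_descFactorial h]
  push_cast
  ring

/-- The terminating well-poised sum with one free parameter. -/
theorem dixon_polynomial [CharZero k] (p : ℕ) :
    ∑ i ∈ Finset.range (2 * p + 1), Polynomial.C ((-1) ^ i * ((2 * p).choose i : k) /
        (i.factorial * (2 * p - i).factorial)) * (ascPochhammer k i * ascPochhammer k (2 * p - i)) =
      Polynomial.C (1 / (p.factorial : k) ^ 2) *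
        (ascPochhammer k p * (ascPochhammer k p).comp (1 - Polynomial.X)) := by
  classical
  have hinj : Function.Injective (fun j : ℕ => (j : k) - p) := fun a b h => by
    simpa using h
  have hp0 : (p.factorial : k) ≠ 0 := by exact_mod_cast p.factorial_ne_zero
  have hcard : ((Finset.range (2 * p + 1)).image (fun j : ℕ => (j : k) - p)).card = 2 * p + 1 := by
    rw [Finset.card_image_of_injective _ hinj, Finset.card_range]
  have hlin : (1 - Polynomial.X : Polynomial k).natDegree ≤ 1 := by
    refine (Polynomial.natDegree_sub_le _ _).trans ?_
    simp
  -- Both sides have degree at most 2p, so the 2p + 1 points j - p suffice; at all of them but -p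
  -- both sides vanish.
  refine Polynomial.eq_of_degrees_lt_of_eval_finset_eq
    ((Finset.range (2 * p + 1)).image (fun j : ℕ => (j : k) - p)) ?_ ?_ ?_
  · rw [hcard]
    refine lt_of_le_of_lt Polynomial.degree_le_natDegree ?_
    refine WithBot.coe_lt_coe.2 (Nat.lt_succ_of_le (Polynomial.natDegree_sum_le_of_forall_le _ _
      fun i hi => ?_))
    refine (Polynomial.natDegree_C_mul_le _ _).trans (Polynomial.natDegree_mul_le.trans ?_)
    rw [ascPochhammer_natDegree, ascPochhammer_natDegree]
    have := Finset.mem_range.1 hi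
    omega
  · rw [hcard]
    refine lt_of_le_of_lt Polynomial.degree_le_natDegree ?_
    refine WithBot.coe_lt_coe.2 (Nat.lt_succ_of_le ?_)
    refine (Polynomial.natDegree_C_mul_le _ _).trans (Polynomial.natDegree_mul_le.trans ?_)
    rw [Polynomial.natDegree_comp, ascPochhammer_natDegree]
    nlinarith
  · intro b hb
    obtain ⟨j, hj, rfl⟩ := Finset.mem_image.1 hb
    have hj := Finset.mem_range.1 hj
    simp only [Polynomial.eval_finsetSum, Polynomial.eval_mul, Polynomial.eval_C,
      Polynomial.eval_comp, Polynomial.eval_sub, Polynomial.eval_one, Polynomial.eval_X]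
    rcases Nat.lt_or_ge p j with h | h
    · obtain ⟨s, rfl⟩ := Nat.exists_eq_add_of_lt h
      have e1 : ((p + s + 1 : ℕ) : k) - p = s + 1 := by push_cast; ring
      have e2 : (1 : k) - (s + 1) = -(s : k) := by ring
      rw [e1, e2, ascPochhammer_eval_neg_coe_nat_of_lt (by omega : s < p), mul_zero, mul_zero]
      -- Since (s+1)_i / i! = (i+1)_s / s!, the left side at s + 1 is an alternating binomial sum of
      -- values of G, whose degree is at most 2s < 2p.
      set G : Polynomial k := Polynomial.C (1 / (s.factorial : k) ^ 2) *
        ((ascPochhammer k s).comp (Polynomial.X + 1) *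
          (ascPochhammer k s).comp (Polynomial.C ((2 * p : ℕ) : k) - Polynomial.X + 1)) with hG
      have hGd : G.natDegree < 2 * p := by
        have h1 : (Polynomial.X + 1 : Polynomial k).natDegree ≤ 1 := by
          refine (Polynomial.natDegree_add_le _ _).trans ?_
          simp
        have h2 : (Polynomial.C ((2 * p : ℕ) : k) - Polynomial.X + 1 : Polynomial k).natDegree
            ≤ 1 := by
          refine (Polynomial.natDegree_add_le _ _).trans (max_le ?_ (by simp))
          refine (Polynomial.natDegree_sub_le _ _).trans (max_le ?_ (by simp))
          rw [Polynomial.natDegree_C]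
          exact Nat.zero_le _
        refine lt_of_le_of_lt ((Polynomial.natDegree_C_mul_le _ _).trans
          Polynomial.natDegree_mul_le) ?_
        rw [Polynomial.natDegree_comp, Polynomial.natDegree_comp, ascPochhammer_natDegree]
        nlinarith
      rw [← alternating_sum_choose_mul_eval G hGd]
      refine Finset.sum_congr rfl fun i hi => ?_
      obtain ⟨c, hc⟩ := Nat.exists_eq_add_of_le (Nat.lt_succ_iff.1 (Finset.mem_range.1 hi))
      have e3 : ((2 * p : ℕ) : k) - i + 1 = (c : k) + 1 := by rw [hc]; push_cast; ring
      have e4 : 2 * p - i = c := by omega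
      simp only [hG, Polynomial.eval_mul, Polynomial.eval_C, Polynomial.eval_comp,
        Polynomial.eval_add, Polynomial.eval_sub, Polynomial.eval_X, Polynomial.eval_one, e3, e4,
        ascPochhammer_eval_natCast_succ, add_comm i s, add_comm c s]
      field_simp
    · obtain ⟨r, rfl⟩ := Nat.exists_eq_add_of_le h
      have e1 : (j : k) - ((j + r : ℕ) : k) = -(r : k) := by push_cast; ring
      rw [e1]
      rcases Nat.eq_zero_or_pos j with rfl | hj0
      · rw [Finset.sum_eq_single r]
        · have e2 : (1 : k) - -(r : k) = (r : k) + 1 := by ring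
          have e4 := Nat.add_choose_mul_factorial_mul_factorial r r
          have e5 : ((r + r).choose r : k) * r.factorial * r.factorial = (r + r).factorial := by
            exact_mod_cast e4
          rw [zero_add] at hp0
          simp only [zero_add, two_mul, Nat.add_sub_cancel]
          rw [e2, ascPochhammer_eval_neg_natCast le_rfl, ascPochhammer_eval_natCast_succ, ← e5]
          simp only [Nat.sub_self, Nat.factorial_zero, Nat.cast_one, div_one]
          have h1 : ((-1 : k) ^ r) * (-1) ^ r = 1 := by rw [← mul_pow]; simp
          field_simp
          linear_combination ((r + r).choose r : k) * h1
        · intro i hi hir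
          rcases Nat.lt_or_ge r i with h3 | h3
          · rw [ascPochhammer_eval_neg_coe_nat_of_lt h3, zero_mul, mul_zero]
          · rw [ascPochhammer_eval_neg_coe_nat_of_lt (by omega : r < 2 * (0 + r) - i), mul_zero,
              mul_zero]
        · intro h3
          exact absurd (Finset.mem_range.2 (by omega)) h3
      · rw [ascPochhammer_eval_neg_coe_nat_of_lt (by omega : r < j + r), zero_mul, mul_zero]
        -- Here r < p, so i or 2p - i exceeds r and its Pochhammer factor vanishes.
        refine Finset.sum_eq_zero fun i hi => ?_
        rcases Nat.lt_or_ge r i with h3 | h3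
        · rw [ascPochhammer_eval_neg_coe_nat_of_lt h3, zero_mul, mul_zero]
        · rw [ascPochhammer_eval_neg_coe_nat_of_lt (by omega : r < 2 * (j + r) - i), mul_zero,
            mul_zero]

/-- The value X = 2p + 1 of the free parameter in `dixon_polynomial`. -/
theorem dixon_sum [CharZero k] (p : ℕ) :
    ∑ i ∈ Finset.range (2 * p + 1), (-1 : k) ^ i * ((2 * p).choose i : k) ^ 2 *
      ((4 * p - i).factorial * (2 * p + i).factorial) =
      (-1) ^ p * (3 * p).factorial * ((2 * p).factorial : k) ^ 3 / (p.factorial : k) ^ 3 := by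
  have h := congrArg (Polynomial.eval (((2 * p : ℕ) : k) + 1)) (dixon_polynomial (k := k) p)
  have e1 : (1 : k) - (((2 * p : ℕ) : k) + 1) = -((2 * p : ℕ) : k) := by ring
  simp only [Polynomial.eval_finsetSum, Polynomial.eval_mul, Polynomial.eval_C,
    Polynomial.eval_comp, Polynomial.eval_sub, Polynomial.eval_one, Polynomial.eval_X, e1,
    ascPochhammer_eval_natCast_succ, ascPochhammer_eval_neg_natCast (by omega : p ≤ 2 * p)] at h
  have hp0 : (p.factorial : k) ≠ 0 := by exact_mod_cast p.factorial_ne_zero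
  have hq0 : ((2 * p).factorial : k) ≠ 0 := by exact_mod_cast (2 * p).factorial_ne_zero
  have e2 : 2 * p - p = p := by omega
  have e3 : 2 * p + p = 3 * p := by omega
  rw [e2, e3] at h
  have h2 : ∑ i ∈ Finset.range (2 * p + 1), (-1 : k) ^ i * ((2 * p).choose i : k) ^ 2 *
      ((4 * p - i).factorial * (2 * p + i).factorial) = ((2 * p).factorial : k) ^ 3 *
      ∑ i ∈ Finset.range (2 * p + 1), (-1 : k) ^ i * ((2 * p).choose i : k) /
        (i.factorial * (2 * p - i).factorial) * (((2 * p + i).factorial : k) /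
        (2 * p).factorial * (((2 * p + (2 * p - i)).factorial : k) / (2 * p).factorial)) := by
    rw [Finset.mul_sum]
    refine Finset.sum_congr rfl fun i hi => ?_
    have hi' := Nat.lt_succ_iff.1 (Finset.mem_range.1 hi)
    have h3 : ((2 * p).choose i : k) * i.factorial * (2 * p - i).factorial =
        (2 * p).factorial := by
      exact_mod_cast Nat.choose_mul_factorial_mul_factorial hi'
    have h4 : (i.factorial : k) ≠ 0 := by exact_mod_cast i.factorial_ne_zero
    have h5 : ((2 * p - i).factorial : k) ≠ 0 := by exact_mod_cast (2 * p - i).factorial_ne_zero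
    rw [show 2 * p + (2 * p - i) = 4 * p - i by omega]
    field_simp
    rw [← h3]
    ring
  rw [h2, h]
  field_simp

/-! ### Points supported at the coordinate of weight zero -/

/-- The point of `V_n` whose middle coordinate is `c`, all others being zero. -/
def mid (n : ℕ) (c : k) : Fin (n + 1) → k := fun i => if 2 * (i : ℕ) = n then c else 0

theorem coord_mid {l : ℕ} (c : k) (i : ℕ) :
    coord (mid (2 * l) c) i = if i = l then c else 0 := by
  unfold coord mid
  by_cases h : i = l
  · subst h
    rw [dif_pos (by omega), if_pos rfl, if_pos rfl]
  · rw [if_neg h]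
    split_ifs with h1 h2
    · exact absurd h2 (by simp only; omega)
    · rfl
    · rfl

theorem flow_mid {l : ℕ} (a c : k) (i : Fin (2 * l + 1)) :
    flow a (mid (2 * l) c) i =
      if l ≤ (i : ℕ) then a ^ ((i : ℕ) - l) / (((i : ℕ) - l).factorial : k) * c else 0 := by
  simp only [flow, coord_mid]
  split_ifs with h
  · rw [Finset.sum_eq_single ((i : ℕ) - l)]
    · rw [if_pos (by omega)]
    · intro j hj hjl
      have := Finset.mem_range.1 hj
      rw [if_neg (by omega), mul_zero]
    · intro h1
      exact absurd (Finset.mem_range.2 (by omega)) h1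
  · refine Finset.sum_eq_zero fun j hj => ?_
    rw [if_neg (by omega), mul_zero]

theorem choose_succ_mul_succ (l a : ℕ) :
    ((l.choose (a + 1) : ℕ) : k) * (a + 1) = (l.choose a : k) * ((l : k) - a) := by
  rcases Nat.lt_or_ge l a with h | h
  · rw [Nat.choose_eq_zero_of_lt h, Nat.choose_eq_zero_of_lt (by omega)]
    simp
  · have := congrArg (Nat.cast : ℕ → k) (Nat.choose_succ_right_eq l a)
    push_cast [Nat.cast_sub h] at this
    exact this

/-- The coefficients of `(1 + T Z)^l (1 + (T - 1) Z)^l` as a polynomial in `Z`. -/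
noncomputable def weylCoeff (k : Type u) [Field k] (l m : ℕ) : Polynomial k :=
  ∑ q ∈ Finset.HasAntidiagonal.antidiagonal m, ((l.choose q.1 : Polynomial k) * Polynomial.X ^ q.1) *
    ((l.choose q.2 : Polynomial k) * (Polynomial.X - 1) ^ q.2)

/-- With Y = 1/Z the generating polynomial is Z^{2l} P(Y + T) for P = Y^l (Y-1)^l, a translate; so
differentiating in T is differentiating in Y, which shifts the coefficients. -/
theorem derivative_weylCoeff (l m : ℕ) :
    Polynomial.derivative (weylCoeff k l (m + 1)) =
      Polynomial.C (2 * (l : k) - m) * weylCoeff k l m := by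
  have key : ∀ a, ((l.choose (a + 1) : ℕ) : Polynomial k) * ((a : Polynomial k) + 1) =
      (l.choose a : Polynomial k) * ((l : Polynomial k) - a) := by
    intro a
    have := congrArg Polynomial.C (choose_succ_mul_succ (k := k) l a)
    simpa using this
  have h1 : Polynomial.derivative (weylCoeff k l (m + 1)) =
      ∑ q ∈ Finset.HasAntidiagonal.antidiagonal (m + 1),
        Polynomial.derivative ((l.choose q.1 : Polynomial k) * Polynomial.X ^ q.1) *
          ((l.choose q.2 : Polynomial k) * (Polynomial.X - 1) ^ q.2) +
      ∑ q ∈ Finset.HasAntidiagonal.antidiagonal (m + 1),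
        ((l.choose q.1 : Polynomial k) * Polynomial.X ^ q.1) *
          Polynomial.derivative ((l.choose q.2 : Polynomial k) * (Polynomial.X - 1) ^ q.2) := by
    rw [weylCoeff, Polynomial.derivative_sum, ← Finset.sum_add_distrib]
    exact Finset.sum_congr rfl fun q _ => Polynomial.derivative_mul
  rw [h1, Finset.Nat.sum_antidiagonal_succ, Finset.Nat.sum_antidiagonal_succ', weylCoeff,
    Finset.mul_sum]
  simp only [pow_zero, mul_one, Nat.choose_zero_right, Nat.cast_one, Polynomial.derivative_one,
    zero_mul, mul_zero, zero_add]
  rw [← Finset.sum_add_distrib]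
  refine Finset.sum_congr rfl fun q hq => ?_
  have hq : (m : Polynomial k) = q.1 + q.2 := by
    rw [← Finset.HasAntidiagonal.mem_antidiagonal.1 hq]
    push_cast
    rfl
  simp only [Polynomial.derivative_natCast_mul,
    Polynomial.derivative_pow, Polynomial.derivative_sub, Polynomial.derivative_X,
    Polynomial.derivative_one, Nat.add_sub_cancel, Polynomial.C_sub, Polynomial.C_mul,
    Polynomial.C_add, map_one, map_natCast, map_ofNat, hq, sub_zero, mul_one, Nat.cast_add,
    Nat.cast_one]
  have k1 := key q.1
  have k2 := key q.2
  linear_combination (Polynomial.X ^ q.1 * (l.choose q.2 : Polynomial k) *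
    (Polynomial.X - 1) ^ q.2) * k1 + (Polynomial.X ^ q.1 * (l.choose q.1 : Polynomial k) *
    (Polynomial.X - 1) ^ q.2) * k2

theorem eval_zero_weylCoeff (l m : ℕ) :
    (weylCoeff k l m).eval 0 = (-1) ^ m * (l.choose m : k) := by
  rw [weylCoeff, Polynomial.eval_finsetSum, Finset.sum_eq_single (0, m)]
  · simp [mul_comm]
  · rintro ⟨a, b⟩ hq hne
    have : a ≠ 0 := by
      rintro rfl
      rw [Finset.HasAntidiagonal.mem_antidiagonal] at hq
      exact hne (by simp_all)
    simp [this]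
  · simp

theorem eval_one_weylCoeff (l m : ℕ) : (weylCoeff k l m).eval 1 = (l.choose m : k) := by
  rw [weylCoeff, Polynomial.eval_finsetSum, Finset.sum_eq_single (m, 0)]
  · simp
  · rintro ⟨a, b⟩ hq hne
    have : b ≠ 0 := by
      rintro rfl
      rw [Finset.HasAntidiagonal.mem_antidiagonal] at hq
      exact hne (by simp_all)
    simp [this]
  · simp

/-- An integral curve of `Δ_{2l}` joining two points in the `D`-orbits of `mid c` and
`mid ((-1)^l c)`. -/
noncomputable def weylCurve (l : ℕ) (c : k) : R k (2 * l) →ₐ[k] Polynomial k :=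
  aeval fun i => Polynomial.C (c * ((2 * l - (i : ℕ)).factorial : k) / (l.factorial : k)) *
    weylCoeff k l (2 * l - (i : ℕ))

theorem algHom_Delta_X {n : ℕ} (γ : R k n →ₐ[k] Polynomial k) (i : Fin (n + 1)) :
    γ (Delta k n (X i)) =
      Polynomial.C (((n : k) - ((i : ℕ) : k)) * (((i : ℕ) : k) + 1)) * γ (x k n ((i : ℕ) + 1)) := by
  rw [Delta_X, ← C_mul, map_mul, ← MvPolynomial.algebraMap_eq, AlgHom.commutes]
  rfl

theorem derivative_weylCurve_X (l : ℕ) (c : k) (i : Fin (2 * l + 1)) :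
    Polynomial.derivative (weylCurve l c (X i)) = weylCurve l c (Delta k (2 * l) (X i)) := by
  rw [algHom_Delta_X]
  obtain ⟨i, hi⟩ := i
  rcases Nat.lt_or_ge i (2 * l) with h | h
  · have e : x k (2 * l) (i + 1) = X ⟨i + 1, by omega⟩ := by simp [x, h]
    obtain ⟨m, hm⟩ : ∃ m, 2 * l - i = m + 1 := ⟨2 * l - i - 1, by omega⟩
    have hm' : 2 * l - (i + 1) = m := by omega
    have hc : ((2 * l : ℕ) : k) = i + (m + 1) := by
      have : 2 * l = i + (m + 1) := by omega
      rw [this]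
      push_cast
      ring
    simp only [e, weylCurve, aeval_X, hm, hm', Polynomial.derivative_C_mul, derivative_weylCoeff,
      Nat.factorial_succ]
    rw [← mul_assoc, ← mul_assoc, ← Polynomial.C_mul, ← Polynomial.C_mul]
    congr 2
    push_cast at hc ⊢
    rw [hc]
    ring
  · obtain rfl : i = 2 * l := by omega
    simp [x_of_gt, weylCurve, weylCoeff]

theorem factorial_div_mul_choose [CharZero k] {l i : ℕ} (hi : i ≤ 2 * l) :
    ((2 * l - i).factorial : k) / (l.factorial : k) * (l.choose (2 * l - i) : k) =
      if l ≤ i then 1 / ((i - l).factorial : k) else 0 := by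
  split_ifs with h
  · have h1 := Nat.choose_mul_factorial_mul_factorial (n := l) (k := 2 * l - i) (by omega)
    rw [show l - (2 * l - i) = i - l by omega] at h1
    have h2 : (l.factorial : k) ≠ 0 := by exact_mod_cast l.factorial_ne_zero
    have h3 : ((i - l).factorial : k) ≠ 0 := by exact_mod_cast (i - l).factorial_ne_zero
    field_simp
    rw [← h1]
    push_cast
    ring
  · rw [Nat.choose_eq_zero_of_lt (by omega)]
    simp

/-- The Weyl element of SL₂ as a D-flow, a Δ-curve and a D-flow: g is constant on each piece. The
Δ-curve runs from (1 - Z)^l at T = 0 to (1 + Z)^l at T = 1, in the orbits of the two middle points.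
-/
theorem eval_mid_neg_one_pow [CharZero k] {l : ℕ} {g : R k (2 * l)} (hD : g ∈ A k (2 * l))
    (hΔ : Delta k (2 * l) g = 0) (c : k) :
    eval (mid (2 * l) ((-1) ^ l * c)) g = eval (mid (2 * l) c) g := by
  have h := eval_eq_of_curve _ (weylCurve l c) (derivative_weylCurve_X l c) hΔ 0 1
  have e0 : (fun i => (weylCurve l c (X i)).eval 0) =
      flow (-1) (mid (2 * l) ((-1) ^ l * c)) := by
    funext i
    have hi : (i : ℕ) ≤ 2 * l := Nat.lt_succ_iff.1 i.2
    have h2 := factorial_div_mul_choose (k := k) hi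
    simp only [weylCurve, aeval_X, Polynomial.eval_mul, Polynomial.eval_C, eval_zero_weylCoeff,
      flow_mid]
    rw [show c * ((2 * l - (i : ℕ)).factorial : k) / (l.factorial : k) *
      ((-1) ^ (2 * l - (i : ℕ)) * (l.choose (2 * l - (i : ℕ)) : k)) =
      c * (-1) ^ (2 * l - (i : ℕ)) * (((2 * l - (i : ℕ)).factorial : k) / (l.factorial : k) *
        (l.choose (2 * l - (i : ℕ)) : k)) by ring, h2]
    split_ifs with h3
    · have h4 : (-1 : k) ^ (2 * l - (i : ℕ)) = (-1) ^ ((i : ℕ) - l) * (-1) ^ l := by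
        rw [← pow_add, show (i : ℕ) - l + l = i by omega]
        have h5 : (-1 : k) ^ (2 * l - (i : ℕ)) * (-1) ^ (i : ℕ) = 1 := by
          rw [← pow_add, Nat.sub_add_cancel hi, pow_mul]
          simp
        have h6 : (-1 : k) ^ (i : ℕ) * (-1) ^ (i : ℕ) = 1 := by rw [← mul_pow]; simp
        linear_combination (-1 : k) ^ (i : ℕ) * h5 - (-1 : k) ^ (2 * l - (i : ℕ)) * h6
      rw [h4]
      ring
    · ring
  have e1 : (fun i => (weylCurve l c (X i)).eval 1) = flow 1 (mid (2 * l) c) := by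
    funext i
    have hi : (i : ℕ) ≤ 2 * l := Nat.lt_succ_iff.1 i.2
    have h2 := factorial_div_mul_choose (k := k) hi
    simp only [weylCurve, aeval_X, Polynomial.eval_mul, Polynomial.eval_C, eval_one_weylCoeff,
      flow_mid]
    rw [mul_div_assoc, mul_assoc, h2]
    split_ifs <;> simp [mul_comm]
  rw [e0, e1, eval_flow hD, eval_flow hD] at h
  exact h

/-- If `n ≡ 2 (mod 4)`, an invariant is an even function of the middle coordinate. -/
theorem eval_mid_neg [CharZero k] {l : ℕ} (hl : Odd l) {g : R k (2 * l)} (hg : g ∈ A k (2 * l))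
    (c : k) : eval (mid (2 * l) (-c)) g = eval (mid (2 * l) c) g := by
  have hmid : ∀ c : k, ∀ i : Fin (2 * l + 1), 2 * (i : ℕ) ≠ 2 * l → mid (2 * l) c i = 0 :=
    fun c i hi => if_neg hi
  rw [← eval_weightedHomogeneousComponent_zero g (hmid (-c)),
    ← eval_weightedHomogeneousComponent_zero g (hmid c)]
  have := eval_mid_neg_one_pow (weightedHomogeneousComponent_mem_A hg 0)
    (Delta_weightedHomogeneousComponent_zero hg) c
  rwa [hl.neg_one_pow, neg_one_mul] at this

/-! ### The semitransvectant -/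

/-- The integral curve of `Δ_{2l}` through `mid c`. -/
noncomputable def midCurve (l : ℕ) (c : k) : R k (2 * l) →ₐ[k] Polynomial k :=
  aeval fun i => Polynomial.C (c * ((2 * l - (i : ℕ)).factorial : k) / (l.factorial : k) *
    (l.choose i : k)) * Polynomial.X ^ (l - (i : ℕ))

theorem midCurve_x {l i : ℕ} (c : k) (hi : i ≤ 2 * l) : midCurve l c (x k (2 * l) i) =
    Polynomial.C (c * ((2 * l - i).factorial : k) / (l.factorial : k) * (l.choose i : k)) *
      Polynomial.X ^ (l - i) := by
  have e : x k (2 * l) i = X ⟨i, by omega⟩ := by simp [x, hi]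
  rw [e]
  simp [midCurve]

theorem derivative_midCurve_X (l : ℕ) (c : k) (i : Fin (2 * l + 1)) :
    Polynomial.derivative (midCurve l c (X i)) = midCurve l c (Delta k (2 * l) (X i)) := by
  rw [algHom_Delta_X, ← x_val, midCurve_x c (Nat.lt_succ_iff.1 i.2)]
  obtain ⟨i, hi⟩ := i
  rcases Nat.lt_or_ge i (2 * l) with h | h
  · rw [midCurve_x c (by exact h), Polynomial.derivative_C_mul_X_pow, ← mul_assoc,
      ← Polynomial.C_mul, Nat.sub_sub]
    congr 2
    simp only
    obtain ⟨m, hm⟩ : ∃ m, 2 * l - i = m + 1 := ⟨2 * l - i - 1, by omega⟩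
    have hm' : 2 * l - (i + 1) = m := by omega
    have hc : ((2 * l : ℕ) : k) = i + (m + 1) := by
      have : 2 * l = i + (m + 1) := by omega
      rw [this]
      push_cast
      ring
    have h1 := choose_succ_mul_succ (k := k) l i
    have h2 : (l.choose i : k) * ((l - i : ℕ) : k) = (l.choose i : k) * ((l : k) - i) := by
      rcases Nat.lt_or_ge l i with h3 | h3
      · rw [Nat.choose_eq_zero_of_lt h3]
        simp
      · rw [Nat.cast_sub h3]
    rw [hm, hm', hc, Nat.factorial_succ]
    push_cast
    linear_combination (c * ((m + 1) * m.factorial) / l.factorial) * (h2 - h1)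
  · obtain rfl : i = 2 * l := by omega
    rw [x_of_gt (by simp), map_zero, mul_zero, show l - 2 * l = 0 by omega]
    simp

theorem eval_midCurve_zero [CharZero k] (l : ℕ) (c : k) (i : Fin (2 * l + 1)) :
    (midCurve l c (X i)).eval 0 = mid (2 * l) c i := by
  rw [← x_val, midCurve_x c (Nat.lt_succ_iff.1 i.2)]
  simp only [Polynomial.eval_mul, Polynomial.eval_C, Polynomial.eval_pow, Polynomial.eval_X, mid]
  split_ifs with h
  · have : (i : ℕ) = l := by omega
    have h2 : (l.factorial : k) ≠ 0 := by exact_mod_cast l.factorial_ne_zero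
    rw [this, show 2 * l - l = l by omega]
    simp [h2]
  · rcases Nat.lt_or_ge l i with h3 | h3
    · rw [Nat.choose_eq_zero_of_lt h3]
      simp
    · rw [zero_pow (by omega), mul_zero]

/-- Iterates of Δ at the middle point become derivatives at 0 of a single polynomial, so they need
not be computed symbolically. -/
theorem eval_mid_Delta_iterate [CharZero k] (l : ℕ) (c : k) (g : R k (2 * l)) (j : ℕ) :
    eval (mid (2 * l) c) ((Delta k (2 * l))^[j] g) =
      (Polynomial.derivative^[j] (midCurve l c g)).eval 0 := by
  rw [iterate_derivative_algHom _ _ (derivative_midCurve_X l c), eval_algHom]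
  congr 2
  funext i
  rw [eval_midCurve_zero]

theorem sum_range_two_mul_add_one (a : ℕ → k) (p : ℕ)
    (h : ∀ i < p, a (2 * p - i) = a i) :
    ∑ i ∈ Finset.range (2 * p + 1), a i = 2 * ∑ i ∈ Finset.range p, a i + a p := by
  rw [show 2 * p + 1 = p + (1 + p) by omega, Finset.sum_range_add, Finset.sum_range_add,
    Finset.sum_range_one, ← Finset.sum_range_reflect (fun i => a (p + (1 + i)))]
  rw [Finset.sum_congr rfl (fun i hi => ?_ : ∀ i ∈ Finset.range p,
    a (p + (1 + (p - 1 - i))) = a i)]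
  · simp only [add_zero]
    ring
  · have := Finset.mem_range.1 hi
    rw [← h i this]
    congr 1
    omega

/-! ### The invariants `f_m`, the local slices `s_m` and the elements `ε_s(a)` -/

theorem alternating_sum_add {B : Type*} [CommRing B] (b : ℕ → B) (m : ℕ) :
    ∑ i ∈ Finset.range m, (-1) ^ i * (b i + b (i + 1)) = b 0 - (-1) ^ m * b m := by
  induction m with
  | zero => simp
  | succ m ih => rw [Finset.sum_range_succ, ih, pow_succ]; ring

theorem Derivation.map_neg_one_pow_mul {B : Type*} [CommRing B] [Algebra k B]
    (δ : Derivation k B B) (i : ℕ) (g : B) : δ ((-1) ^ i * g) = (-1) ^ i * δ g := by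
  rcases Nat.even_or_odd i with h | h <;> simp [h.neg_one_pow]

/-- The sequence `x_{i-1}`, with `x_{-1} = 0`. -/
noncomputable def xPred (k : Type u) [Field k] (n : ℕ) : ℕ → R k n
  | 0 => 0
  | i + 1 => x k n i

theorem xPred_zero (n : ℕ) : xPred k n 0 = 0 := rfl

theorem xPred_succ (n i : ℕ) : xPred k n (i + 1) = x k n i := rfl

theorem D_x {n i : ℕ} (h : i ≤ n) : D k n (x k n i) = xPred k n i := by
  cases i with
  | zero => exact D_x_zero n
  | succ i => exact D_x_succ h

/-- With b_i = x_{i-1} x_{2m-i} and x_{-1} = 0, D(x_i x_{2m-i}) = b_i + b_{i+1}. The alternating sum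
telescopes to the boundary term at m, which the half square cancels. -/
theorem D_quad [CharZero k] {n m : ℕ} (h : 2 * m ≤ n) : D k n (quad k n m) = 0 := by
  have h1 := alternating_sum_add (fun i => xPred k n i * x k n (2 * m - i)) m
  have h2 : D k n (∑ i ∈ Finset.range m, (-1) ^ i * x k n i * x k n (2 * m - i)) =
      ∑ i ∈ Finset.range m, (-1) ^ i * (xPred k n i * x k n (2 * m - i) +
        xPred k n (i + 1) * x k n (2 * m - (i + 1))) := by
    rw [map_sum]
    refine Finset.sum_congr rfl fun i hi => ?_
    have hi := Finset.mem_range.1 hi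
    obtain ⟨c, hc⟩ : ∃ c, 2 * m - i = c + 1 := ⟨2 * m - i - 1, by omega⟩
    rw [mul_assoc, Derivation.map_neg_one_pow_mul, Derivation.leibniz, smul_eq_mul, smul_eq_mul,
      D_x (by omega), D_x (by omega), hc, show 2 * m - (i + 1) = c by omega]
    simp only [xPred_succ]
    ring
  rw [quad, map_add, h2, h1, mul_assoc, Derivation.map_C_mul, Derivation.map_neg_one_pow_mul,
    Derivation.leibniz_pow, D_x (by omega), show 2 * m - m = m by omega]
  have h3 : C (1 / 2) * (2 : R k n) = 1 := by
    rw [← map_ofNat (C (σ := Fin (n + 1)) (R := k)) 2, ← C_mul]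
    simp
  simp only [xPred_zero, zero_mul, zero_sub, Nat.add_one_sub_one, pow_one, smul_eq_mul, nsmul_eq_mul,
    Nat.cast_ofNat]
  linear_combination ((-1) ^ m * (x k n m * xPred k n m)) * h3

theorem f_mem_A [CharZero k] {n m : ℕ} (h : m ≤ n / 2) : f k n m ∈ A k n := by
  rw [mem_A, f]
  split_ifs
  · exact D_x_zero n
  · exact D_quad (by omega)

/-- Summation by parts: the coefficients m - i + 1/2 drop by 1 at each step, so what remains of the
telescoping sum is f_m. The last coefficient 1/2 produces the half square. -/
theorem D_s [CharZero k] {n m : ℕ} (hn : 1 ≤ n) (h : m ≤ (n - 1) / 2) :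
    D k n (s k n m) = f k n m := by
  unfold s f
  split_ifs with hm
  · exact D_x_succ hn
  have h2 : C (2 : k) * C (1 / 2) = (1 : R k n) := by
    rw [← C_mul]
    simp
  have hC : ∀ i : ℕ, C ((2 * (m : k) + 1 - 2 * (i : k)) / 2) =
      ((m : R k n) - (i : R k n) + C (1 / 2)) := by
    intro i
    rw [show (2 * (m : k) + 1 - 2 * (i : k)) / 2 = m - i + 1 / 2 by field_simp; ring, C_add, C_sub,
      map_natCast, map_natCast]
  have key : ∀ b : ℕ → R k n, ∑ i ∈ Finset.range m, (-1) ^ i *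
      C ((2 * (m : k) + 1 - 2 * (i : k)) / 2) * (b i + b (i + 1)) =
      C ((2 * (m : k) + 1) / 2) * b 0 - (-1) ^ m * C (1 / 2) * b m
        + ∑ i ∈ Finset.range m, (-1) ^ i * b (i + 1) := by
    intro b
    have hC0 := hC 0
    simp only [Nat.cast_zero, mul_zero, sub_zero] at hC0
    rw [hC0]
    have : ∀ j ≤ m, ∑ i ∈ Finset.range j, (-1) ^ i *
      C ((2 * (m : k) + 1 - 2 * (i : k)) / 2) * (b i + b (i + 1)) =
      ((m : R k n) + C (1 / 2)) * b 0 - (-1) ^ j * ((m : R k n) - (j : R k n) + C (1 / 2)) * b j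
        + ∑ i ∈ Finset.range j, (-1) ^ i * b (i + 1) := by
      intro j hj
      induction j with
      | zero => simp
      | succ j ih =>
        rw [Finset.sum_range_succ, Finset.sum_range_succ, ih (by omega), hC, pow_succ]
        push_cast
        ring
    rw [this m le_rfl]
    ring
  have h3 : D k n (∑ i ∈ Finset.range (m + 1), (-1) ^ i *
      C ((2 * (m : k) + 1 - 2 * (i : k)) / 2) * x k n i * x k n (2 * m + 1 - i)) =
      ∑ i ∈ Finset.range (m + 1), (-1) ^ i * C ((2 * (m : k) + 1 - 2 * (i : k)) / 2) *
        (xPred k n i * x k n (2 * m + 1 - i) +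
          xPred k n (i + 1) * x k n (2 * m + 1 - (i + 1))) := by
    rw [map_sum]
    refine Finset.sum_congr rfl fun i hi => ?_
    have hi := Finset.mem_range.1 hi
    obtain ⟨c, hc⟩ : ∃ c, 2 * m + 1 - i = c + 1 := ⟨2 * m + 1 - i - 1, by omega⟩
    rw [mul_assoc, mul_assoc, Derivation.map_neg_one_pow_mul, Derivation.map_C_mul,
      Derivation.leibniz, smul_eq_mul, smul_eq_mul, D_x (by omega), D_x (by omega), hc,
      show 2 * m + 1 - (i + 1) = c by omega]
    simp only [xPred_succ]
    ring
  rw [h3, Finset.sum_range_succ, key (fun i => xPred k n i * x k n (2 * m + 1 - i)), quad, hC]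
  have h4 : ∑ i ∈ Finset.range m, (-1) ^ i *
      (xPred k n (i + 1) * x k n (2 * m + 1 - (i + 1))) =
      ∑ i ∈ Finset.range m, (-1) ^ i * x k n i * x k n (2 * m - i) := by
    refine Finset.sum_congr rfl fun i hi => ?_
    rw [show 2 * m + 1 - (i + 1) = 2 * m - i by omega]
    simp only [xPred_succ]
    ring
  rw [h4, show 2 * m + 1 - (m + 1) = m by omega]
  simp only [xPred_zero, xPred_succ]
  ring

/-- D of the partial sum up to N telescopes to one term containing D^{N+1} a, which is zero at N =
ν(a). -/
theorem D_eps [CharZero k] {n : ℕ} {s a : R k n} (hs : D k n (D k n s) = 0)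
    (ha : (D k n)^[nu a + 1] a = 0) : D k n (eps s a) = 0 := by
  have key : ∀ N ≤ nu a, D k n (∑ j ∈ Finset.range (N + 1),
      C ((-1) ^ j / (j.factorial : k)) * (D k n)^[j] a * s ^ j * (D k n s) ^ (nu a - j)) =
      C ((-1) ^ N / (N.factorial : k)) * (D k n)^[N + 1] a * s ^ N * (D k n s) ^ (nu a - N) := by
    have hpow : ∀ N, D k n ((D k n s) ^ N) = 0 := by
      intro N
      rw [Derivation.leibniz_pow, hs]
      simp
    intro N
    induction N with
    | zero =>
      intro _
      rw [Finset.sum_range_one, mul_assoc, mul_assoc, Derivation.map_C_mul]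
      simp [hpow, mul_comm]
    | succ N ih =>
      intro hN
      obtain ⟨c, hc⟩ : ∃ c, nu a - N = c + 1 := ⟨nu a - N - 1, by omega⟩
      have h1 : C ((-1) ^ (N + 1) / ((N + 1).factorial : k)) * ((N : R k n) + 1) =
          - C ((-1) ^ N / (N.factorial : k)) := by
        have h2 : ((N : R k n) + 1) = C ((N : k) + 1) := by simp
        rw [h2, ← C_mul, ← C_neg, Nat.factorial_succ]
        congr 1
        have := Nat.cast_add_one_ne_zero (R := k) N
        have : (N.factorial : k) ≠ 0 := by exact_mod_cast N.factorial_ne_zero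
        push_cast
        field_simp
        ring
      have h3 : C ((-1) ^ (N + 1) / ((N + 1).factorial : k)) * (D k n)^[N + 1] a * s ^ (N + 1) *
          (D k n s) ^ (nu a - (N + 1)) = C ((-1) ^ (N + 1) / ((N + 1).factorial : k)) *
          ((D k n)^[N + 1] a * (s ^ (N + 1) * (D k n s) ^ (nu a - (N + 1)))) := by ring
      rw [Finset.sum_range_succ, map_add, ih (by omega), h3, Derivation.map_C_mul,
        Derivation.leibniz, Derivation.leibniz, hpow,
        ← Function.iterate_succ_apply' (D k n) (N + 1), Derivation.leibniz_pow, hc,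
        show nu a - (N + 1) = c by omega]
      simp only [smul_eq_mul, Nat.add_sub_cancel, nsmul_eq_mul, Nat.cast_add, Nat.cast_one,
        mul_zero, zero_add]
      linear_combination ((D k n)^[N + 1] a * s ^ N * (D k n s) ^ c * D k n s) * h1
  rw [eps, key _ le_rfl, ha]
  simp

theorem eps_mem_A [CharZero k] {n j : ℕ} {s : R k n} (hs : D k n s ∈ A k n) (hj : j ≤ n) :
    eps s (x k n j) ∈ A k n := by
  refine D_eps hs ?_
  rw [nu_x hj, D_iterate_x hj, if_neg (by omega)]

theorem eps_x {n j : ℕ} (s : R k n) (hj : j ≤ n) : eps s (x k n j) =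
    ∑ i ∈ Finset.range (j + 1), C ((-1) ^ i / (i.factorial : k)) * x k n (j - i) * s ^ i *
      (D k n s) ^ (j - i) := by
  rw [eps, nu_x hj]
  refine Finset.sum_congr rfl fun i hi => ?_
  rw [D_iterate_x hj, if_pos (Nat.lt_succ_iff.1 (Finset.mem_range.1 hi))]

/-- Evaluation of `ε_s(x_j)` amounts to moving a point along its orbit until `s` vanishes. -/
theorem eval_eps_x {n : ℕ} (s : R k n) (i : Fin (n + 1)) (u : Fin (n + 1) → k)
    (h : eval u (D k n s) ≠ 0) : eval u (eps s (x k n i)) =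
      eval u (D k n s) ^ (i : ℕ) * flow (-(eval u s / eval u (D k n s))) u i := by
  rw [eps_x s (Nat.lt_succ_iff.1 i.2), map_sum, flow, Finset.mul_sum]
  refine Finset.sum_congr rfl fun j hj => ?_
  have hj := Nat.lt_succ_iff.1 (Finset.mem_range.1 hj)
  obtain ⟨c, hc⟩ := Nat.exists_eq_add_of_le hj
  simp only [map_mul, eval_C, eval_x, map_pow]
  rw [neg_pow (_ / _), div_pow, hc, Nat.add_sub_cancel_left, pow_add]
  field_simp

/-! ### Values of `f_m` and `s_m` -/

theorem eval_quad {n : ℕ} (m : ℕ) (u : Fin (n + 1) → k) : eval u (quad k n m) =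
    ∑ i ∈ Finset.range m, (-1) ^ i * coord u i * coord u (2 * m - i)
      + 1 / 2 * (-1) ^ m * coord u m ^ 2 := by
  simp [quad]

theorem eval_quad_of_coord_eq_zero {n m : ℕ} {u : Fin (n + 1) → k}
    (hu : ∀ i < m, coord u i = 0) :
    eval u (quad k n m) = 1 / 2 * (-1) ^ m * coord u m ^ 2 := by
  rw [eval_quad, Finset.sum_eq_zero, zero_add]
  intro i hi
  rw [hu i (Finset.mem_range.1 hi)]
  ring

/-- Once the earlier coordinates vanish, f_i is ±x_i²/2 (or x_0), so the coordinates vanish one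
after another. -/
theorem coord_eq_zero_of_eval_f_eq_zero [CharZero k] {n M : ℕ} {u : Fin (n + 1) → k}
    (h : ∀ m < M, eval u (f k n m) = 0) : ∀ i < M, coord u i = 0 := by
  intro i
  induction i using Nat.strong_induction_on with
  | _ i ih =>
    intro hi
    have h1 := h i hi
    unfold f at h1
    split_ifs at h1 with h0
    · subst h0
      simpa using h1
    · rw [eval_quad_of_coord_eq_zero fun j hj => ih j hj (by omega)] at h1
      simpa using h1

theorem eval_f_of_coord_eq_zero {n m : ℕ} {u : Fin (n + 1) → k}
    (hu : ∀ i ≤ m, coord u i = 0) : eval u (f k n m) = 0 := by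
  unfold f
  split_ifs with h
  · simp [hu 0 (Nat.zero_le _)]
  · rw [eval_quad_of_coord_eq_zero fun i hi => hu i hi.le, hu m le_rfl]
    simp

/-- The separation property on the locus where a local slice has nonzero derivative. -/
theorem eval_eq_of_eps_eq [CharZero k] {n : ℕ} (s : R k n) {u v : Fin (n + 1) → k}
    (h0 : eval u (D k n s) ≠ 0) (hD : eval u (D k n s) = eval v (D k n s))
    (h : ∀ j ≤ n, eval u (eps s (x k n j)) = eval v (eps s (x k n j))) {g : R k n}
    (hg : g ∈ A k n) : eval u g = eval v g := by
  -- The points with s = 0 on the two orbits coincide.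
  have h1 : flow (-(eval u s / eval u (D k n s))) u = flow (-(eval v s / eval v (D k n s))) v := by
    funext i
    have h2 := h i (Nat.lt_succ_iff.1 i.2)
    rw [eval_eps_x s i u h0, eval_eps_x s i v (hD ▸ h0), hD] at h2
    rw [hD] at h0 ⊢
    exact mul_left_cancel₀ (pow_ne_zero _ h0) h2
  rw [← eval_flow hg (-(eval u s / eval u (D k n s))) u, h1, eval_flow hg]

theorem eval_eps_x_of_coord_eq_zero {n j : ℕ} (s : R k n) (hj : j ≤ n) {u : Fin (n + 1) → k}
    (hu : ∀ i ≤ j, coord u i = 0) : eval u (eps s (x k n j)) = 0 := by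
  rw [eps_x s hj, map_sum]
  refine Finset.sum_eq_zero fun i _ => ?_
  simp [hu (j - i) (Nat.sub_le _ _)]

theorem eval_eps_x_of_eval_D_eq_zero {n j : ℕ} (s : R k n) (hj : j ≤ n) {u : Fin (n + 1) → k}
    (hu : eval u (D k n s) = 0) : eval u (eps s (x k n j)) =
      (-1) ^ j / (j.factorial : k) * coord u 0 * eval u s ^ j := by
  rw [eps_x s hj, map_sum, Finset.sum_eq_single j]
  · simp
  · intro i hi hij
    have := Finset.mem_range.1 hi
    simp only [map_mul, map_pow, hu]
    rw [zero_pow (by omega), mul_zero]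
  · simp

theorem f_ne_zero [CharZero k] {n m : ℕ} (hm : 2 * m ≤ n) : f k n m ≠ 0 := by
  unfold f
  split_ifs with h
  · exact x_ne_zero (Nat.zero_le _)
  · intro h0
    have h1 := congrArg (eval fun i : Fin (n + 1) => if (i : ℕ) = m then (1 : k) else 0) h0
    have hc : ∀ i, coord (fun i : Fin (n + 1) => if (i : ℕ) = m then (1 : k) else 0) i =
        if i = m then 1 else 0 := by
      intro i
      unfold coord
      by_cases hi : i < n + 1
      · rw [dif_pos hi]
      · rw [dif_neg hi, if_neg (by omega)]
    rw [eval_quad_of_coord_eq_zero (fun i hi => by rw [hc, if_neg hi.ne]), hc, if_pos rfl,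
      map_zero] at h1
    simp at h1

theorem isLocalSlice_s [CharZero k] {n m : ℕ} (hn : 1 ≤ n) (h : m ≤ (n - 1) / 2) :
    IsLocalSlice (s k n m) := by
  refine ⟨?_, ?_⟩
  · rw [D_s hn h]
    exact f_mem_A (by omega)
  · rw [D_s hn h]
    exact f_ne_zero (by omega)

/-! ### The extra invariant -/

theorem neg_one_pow_eq_C {n : ℕ} (i : ℕ) : ((-1) ^ i : R k n) = C ((-1) ^ i) := by
  simp

theorem isWeightedHomogeneous_quad {n m : ℕ} :
    (quad k n m).IsWeightedHomogeneous (wt n) (2 * n - 4 * m) := by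
  unfold quad
  refine IsWeightedHomogeneous.add (IsWeightedHomogeneous.sum _ _ _ fun i hi => ?_) ?_
  · have hi := Finset.mem_range.1 hi
    rw [neg_one_pow_eq_C]
    convert (isWeightedHomogeneous_x.C_mul _).mul isWeightedHomogeneous_x using 1
    omega
  · rw [neg_one_pow_eq_C, ← C_mul]
    convert (isWeightedHomogeneous_x.pow 2).C_mul _ using 1
    simp only [nsmul_eq_mul]
    push_cast
    ring

/-- Partial sums telescope by the ladder relation, as q is killed by D and has weight 2n - 4(n/4) =
n. The surviving term contains x_{n-N-1}, which is zero for N = n. -/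
theorem D_wBar [CharZero k] {n : ℕ} (hn : 4 ∣ n) : D k n (wBar k n) = 0 := by
  set q := quad k n (n / 4) with hq
  have hqw : q.IsWeightedHomogeneous (wt n) n := by
    convert isWeightedHomogeneous_quad (k := k) (n := n) (m := n / 4) using 1
    omega
  have hqD : D k n q = 0 := D_quad (by omega)
  set α : ℕ → k := fun i =>
    (-1) ^ i * ((n.factorial : k) ^ 2 * ((n - i).factorial : k) / (i.factorial : k)) with hα
  have key : ∀ N ≤ n, D k n (∑ i ∈ Finset.range (N + 1),
      C (α i) * x k n (n - i) * (Delta k n)^[i] q) =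
      C (α N) * xPred k n (n - N) * (Delta k n)^[N] q := by
    intro N
    induction N with
    | zero =>
      intro _
      rw [Finset.sum_range_one, mul_assoc, Derivation.map_C_mul, Derivation.leibniz,
        D_x (Nat.sub_le _ _)]
      simp only [Function.iterate_zero, id, hqD, smul_eq_mul]
      ring
    | succ N ih =>
      intro hN
      obtain ⟨c, hc⟩ : ∃ c, n - N = c + 1 := ⟨n - N - 1, by omega⟩
      have hc' : n - (N + 1) = c := by omega
      have hn' : (n : k) = N + (c + 1) := by
        have : n = N + (c + 1) := by omega
        exact_mod_cast this
      -- This recursion is what fixes the coefficients of the semitransvectant.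
      have h1 : C (α N) = - (C (α (N + 1)) * C (((N : k) + 1) * (n - N)) : R k n) := by
        rw [← C_mul, ← C_neg]
        congr 1
        simp only [hα, hc, hc', Nat.factorial_succ, hn']
        have := Nat.cast_add_one_ne_zero (R := k) N
        have : (N.factorial : k) ≠ 0 := by exact_mod_cast N.factorial_ne_zero
        push_cast
        field_simp
        ring
      have h2 := D_Delta_iterate hqw hqD N
      rw [Int.cast_natCast] at h2
      rw [Finset.sum_range_succ, map_add, ih (by omega), mul_assoc (C (α (N + 1))),
        Derivation.map_C_mul, Derivation.leibniz, h2, D_x (Nat.sub_le _ _), hc, hc', h1]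
      simp only [smul_eq_mul, xPred_succ]
      ring
  have h := key n le_rfl
  rw [Nat.sub_self, xPred_zero, mul_zero, zero_mul] at h
  exact h

/-- Every product x_i x_{2p-i} is a multiple of T^{2p} along the curve, so only a constant must be
found; symmetrising in i ↔ 2p - i makes it half a Dixon sum. -/
theorem midCurve_quad [CharZero k] (p : ℕ) (c : k) :
    midCurve (2 * p) c (quad k (2 * (2 * p)) p) =
      Polynomial.C (c ^ 2 / 2 * ((2 * p).factorial : k) *
        ((-1) ^ p * ((3 * p).factorial : k) / (p.factorial : k) ^ 3)) *
      Polynomial.X ^ (2 * p) := by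
  set α : ℕ → k := fun i =>
    c * ((2 * (2 * p) - i).factorial : k) / ((2 * p).factorial : k) * ((2 * p).choose i : k)
    with hα
  have hq0 : ((2 * p).factorial : k) ≠ 0 := by exact_mod_cast (2 * p).factorial_ne_zero
  have h1 : midCurve (2 * p) c (quad k (2 * (2 * p)) p) =
      Polynomial.C (∑ i ∈ Finset.range p, (-1) ^ i * α i * α (2 * p - i)
        + 1 / 2 * (-1) ^ p * α p ^ 2) * Polynomial.X ^ (2 * p) := by
    have hC : ∀ a : k, midCurve (2 * p) c (C a) = Polynomial.C a := fun a => by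
      rw [← MvPolynomial.algebraMap_eq, AlgHom.commutes]
      rfl
    rw [quad, map_add, map_sum, Polynomial.C_add, add_mul, map_sum, Finset.sum_mul]
    congr 1
    · refine Finset.sum_congr rfl fun i hi => ?_
      have hi := Finset.mem_range.1 hi
      rw [neg_one_pow_eq_C, map_mul, map_mul, hC, midCurve_x c (by omega), midCurve_x c (by omega)]
      simp only [hα, Polynomial.C_mul]
      rw [show 2 * p = (2 * p - i) + (2 * p - (2 * p - i)) by omega, pow_add,
        ← show 2 * p = (2 * p - i) + (2 * p - (2 * p - i)) by omega]
      ring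
    · rw [neg_one_pow_eq_C, map_mul, map_mul, hC, hC, map_pow (midCurve (2 * p) c),
        midCurve_x c (by omega)]
      simp only [hα, Polynomial.C_mul, Polynomial.C_pow]
      rw [show 2 * p - p = p by omega]
      ring
  rw [h1]
  congr 2
  have h2 := sum_range_two_mul_add_one (fun i => (-1) ^ i * α i * α (2 * p - i)) p (by
    intro i hi
    rw [show 2 * p - (2 * p - i) = i by omega]
    have : (-1 : k) ^ (2 * p - i) = (-1) ^ i := by
      have h5 : (-1 : k) ^ (2 * p - i) * (-1) ^ i = 1 := by
        rw [← pow_add, Nat.sub_add_cancel (by omega), pow_mul]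
        simp
      have h6 : (-1 : k) ^ i * (-1) ^ i = 1 := by rw [← mul_pow]; simp
      linear_combination (-1 : k) ^ i * h5 - (-1 : k) ^ (2 * p - i) * h6
    rw [this]
    ring)
  have h3 : ∑ i ∈ Finset.range (2 * p + 1), (-1) ^ i * α i * α (2 * p - i) =
      c ^ 2 / ((2 * p).factorial : k) ^ 2 *
      ∑ i ∈ Finset.range (2 * p + 1), (-1 : k) ^ i * ((2 * p).choose i : k) ^ 2 *
      ((4 * p - i).factorial * (2 * p + i).factorial) := by
    rw [Finset.mul_sum]
    refine Finset.sum_congr rfl fun i hi => ?_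
    have hi := Nat.lt_succ_iff.1 (Finset.mem_range.1 hi)
    simp only [hα]
    rw [Nat.choose_symm hi, show 2 * (2 * p) - (2 * p - i) = 2 * p + i by omega,
      show 2 * (2 * p) - i = 4 * p - i by omega]
    field_simp
  rw [dixon_sum] at h3
  simp only [show 2 * p - p = p by omega] at h2
  have h4 : ∑ i ∈ Finset.range p, (-1) ^ i * α i * α (2 * p - i)
        + 1 / 2 * (-1) ^ p * α p ^ 2 =
      1 / 2 * ∑ i ∈ Finset.range (2 * p + 1), (-1) ^ i * α i * α (2 * p - i) := by
    rw [h2]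
    ring
  rw [h4, h3]
  field_simp

/-- At the middle point x_{n-i} kills every term except i = n/2, where Δ^{2p} q is the (2p)-th
derivative of a multiple of T^{2p}. -/
theorem eval_mid_wBar [CharZero k] (p : ℕ) (c : k) :
    eval (mid (2 * (2 * p)) c) (wBar k (2 * (2 * p))) = wFactor k (2 * (2 * p)) * c ^ 3 := by
  have h4 : 2 * (2 * p) / 4 = p := by omega
  have h2 : 2 * (2 * p) / 2 = 2 * p := by omega
  have hq0 : ((2 * p).factorial : k) ≠ 0 := by exact_mod_cast (2 * p).factorial_ne_zero
  rw [wBar, wFactor, h4, h2, map_sum, Finset.sum_eq_single (2 * p)]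
  · rw [map_mul, map_mul, eval_C, eval_x, eval_mid_Delta_iterate, midCurve_quad,
      Polynomial.iterate_derivative_C_mul, Polynomial.iterate_derivative_X_pow_eq_C_mul,
      show 2 * (2 * p) - 2 * p = 2 * p by omega, coord_mid, if_pos rfl]
    simp only [Polynomial.eval_mul, Polynomial.eval_C, Nat.sub_self, pow_zero,
      Polynomial.eval_one, Nat.descFactorial_self]
    rw [pow_mul (-1 : k) 2 p]
    field_simp
    simp
  · intro i hi hne
    have hi := Finset.mem_range.1 hi
    rw [map_mul, map_mul, eval_x, coord_mid, if_neg (by omega), mul_zero, zero_mul]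
  · intro h
    exact absurd (Finset.mem_range.2 (by omega)) h

theorem wFactor_ne_zero [CharZero k] (n : ℕ) : wFactor k n ≠ 0 := by
  have h : ∀ m : ℕ, (m.factorial : k) ≠ 0 := fun m => by exact_mod_cast m.factorial_ne_zero
  unfold wFactor
  have := h n
  have := h (n / 2)
  have := h (n / 4)
  have := h (3 * (n / 4))
  simp_all

theorem eval_proj {m n : ℕ} (z : Fin (m + 1) → k) (g : R k n) : eval z (proj k m n g) =
    eval (fun i : Fin (n + 1) => if (i : ℕ) < n - m then 0 else coord z ((i : ℕ) - (n - m))) g := by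
  have : (aeval z : R k m →ₐ[k] k).comp (proj k m n) = aeval (fun i : Fin (n + 1) =>
      if (i : ℕ) < n - m then 0 else coord z ((i : ℕ) - (n - m))) := by
    apply MvPolynomial.algHom_ext
    intro i
    simp only [proj, AlgHom.comp_apply, aeval_X]
    split_ifs <;> simp [MvPolynomial.aeval_eq_eval]
  simpa [MvPolynomial.aeval_eq_eval] using DFunLike.congr_fun this g

theorem eval_proj_half [CharZero k] {n : ℕ} (hn : Even n) {g : R k n} (hg : g ∈ A k n)
    (z : Fin (n / 2 + 1) → k) : eval z (proj k (n / 2) n g) = eval (mid n (coord z 0)) g := by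
  obtain ⟨l, rfl⟩ := hn
  rw [eval_proj, eval_eq_eval_weight_zero hg]
  · congr 2
    funext i
    unfold mid
    split_ifs with h1 h2
    · omega
    · congr 1
      omega
    · rfl
  · intro i hi
    rw [if_pos (by omega)]

/-- π sets the coordinates of positive weight to zero, and there an invariant depends only on the
middle coordinate, which is x_0 of the smaller ring. -/
theorem isExtraInvariant_iff [CharZero k] {n : ℕ} (hn : Even n) (w : R k n) :
    IsExtraInvariant w ↔ w ∈ A k n ∧ ∀ c, eval (mid n c) w = c ^ 3 := by
  refine and_congr_right fun hw => ⟨fun h c => ?_, fun h => ?_⟩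
  · have h1 := eval_proj_half hn hw (fun _ => c)
    rw [h] at h1
    simpa [coord] using h1.symm
  · apply MvPolynomial.funext
    intro z
    rw [eval_proj_half hn hw, h]
    simp

theorem isExtraInvariant_wInv [CharZero k] {n : ℕ} (hn : 4 ∣ n) :
    IsExtraInvariant (wInv k n) := by
  have hA : wInv k n ∈ A k n := by
    rw [mem_A, wInv, Derivation.map_C_mul, D_wBar hn, mul_zero]
  obtain ⟨p, rfl⟩ : ∃ p, n = 2 * (2 * p) := ⟨n / 4, by omega⟩
  refine (isExtraInvariant_iff (even_two_mul _) _).2 ⟨hA, fun c => ?_⟩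
  rw [wInv, map_mul, eval_C, eval_mid_wBar, inv_mul_cancel_left₀ (wFactor_ne_zero _)]

/-! ### The separation property -/

theorem E_subset_A [CharZero k] {n : ℕ} {w : R k n} (hw : 4 ∣ n → IsExtraInvariant w) :
    E n w ⊆ (A k n : Set (R k n)) := by
  rintro g (((⟨m, hm, rfl⟩ | ⟨j, hj, hjn, rfl⟩) | ⟨m, j, hm, hmn, hj, hjn, rfl⟩) | ⟨h4, rfl⟩)
  · exact f_mem_A hm
  · exact eps_mem_A (isLocalSlice_s (by omega) (Nat.zero_le _)).1 hjn
  · exact eps_mem_A (isLocalSlice_s (by omega) hmn).1 hjn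
  · exact (hw h4).1

theorem eps_s_zero_x_one {n : ℕ} (hn : 1 ≤ n) : eps (s k n 0) (x k n 1) = 0 := by
  rw [eps_x _ hn, s, if_pos rfl, D_x_succ hn, Finset.sum_range_succ, Finset.sum_range_one]
  simp [mul_comm]

theorem eps_s_zero_x_zero (n : ℕ) : eps (s k n 0) (x k n 0) = f k n 0 := by
  rw [eps_x _ (Nat.zero_le _), Finset.sum_range_one]
  simp [f]

theorem isSeparatingSet_E [CharZero k] {n : ℕ} {w : R k n} (hw : 4 ∣ n → IsExtraInvariant w) :
    IsSeparatingSet (E n w) := by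
  refine ⟨E_subset_A hw, fun u v => ?_⟩
  contrapose!
  intro hE g hg
  have hf : ∀ m ≤ n / 2, eval u (f k n m) = eval v (f k n m) := fun m hm =>
    hE _ (Or.inl (Or.inl (Or.inl ⟨m, hm, rfl⟩)))
  -- The bound 2m < n is the range in which the local slice s_m exists.
  by_cases hex : ∃ m, 2 * m < n ∧ eval u (f k n m) ≠ 0
  · classical
    obtain ⟨hm, hm0⟩ := Nat.find_spec hex
    have hmin := fun i (hi : i < Nat.find hex) => Nat.find_min hex hi
    set m := Nat.find hex
    have hu : ∀ i < m, eval u (f k n i) = 0 := fun i hi => by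
      by_contra h
      exact hmin i hi ⟨by omega, h⟩
    have hcu := coord_eq_zero_of_eval_f_eq_zero hu
    have hcv := coord_eq_zero_of_eval_f_eq_zero (u := v) (M := m) fun i hi => by
      rw [← hf i (by omega), hu i hi]
    have hD : D k n (s k n m) = f k n m := D_s (by omega) (by omega)
    refine eval_eq_of_eps_eq (s k n m) (by rwa [hD]) (by rw [hD, hf m (by omega)]) ?_ hg
    intro j hj
    rcases Nat.eq_zero_or_pos m with h0 | h0
    · rw [h0]
      rcases (by omega : j = 0 ∨ j = 1 ∨ 2 ≤ j) with rfl | rfl | h2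
      · rw [eps_s_zero_x_zero, hf 0 (Nat.zero_le _)]
      · rw [eps_s_zero_x_one hj, map_zero, map_zero]
      · exact hE _ (Or.inl (Or.inl (Or.inr ⟨j, h2, hj, rfl⟩)))
    -- For j < m the element ε_{s_m}(x_j) is not in `E_n`, but it vanishes at both points because
    -- the coordinates up to j do.
    · rcases Nat.lt_or_ge j m with h1 | h1
      · rw [eval_eps_x_of_coord_eq_zero _ hj fun i hi => hcu i (by omega),
          eval_eps_x_of_coord_eq_zero _ hj fun i hi => hcv i (by omega)]
      · exact hE _ (Or.inl (Or.inr ⟨m, j, h0, by omega, h1, hj, rfl⟩))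
  · push Not at hex
    -- (n + 1) / 2 is the number of indices i with 2i < n.
    have hcu := coord_eq_zero_of_eval_f_eq_zero (u := u) (M := (n + 1) / 2) fun m hm =>
      hex m (by omega)
    have hcv := coord_eq_zero_of_eval_f_eq_zero (u := v) (M := (n + 1) / 2) fun m hm => by
      rw [← hf m (by omega), hex m (by omega)]
    have hu : ∀ g ∈ A k n, eval u g = eval (mid n (coord u (n / 2))) g := by
      intro g hg
      rw [eval_eq_eval_weight_zero hg fun i hi => by rw [← coord_val u, hcu i (by omega)]]
      congr 2
      funext i
      unfold mid
      split_ifs with h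
      · rw [← coord_val u]
        congr 1
        omega
      · rfl
    have hv : ∀ g ∈ A k n, eval v g = eval (mid n (coord v (n / 2))) g := by
      intro g hg
      rw [eval_eq_eval_weight_zero hg fun i hi => by rw [← coord_val v, hcv i (by omega)]]
      congr 2
      funext i
      unfold mid
      split_ifs with h
      · rw [← coord_val v]
        congr 1
        omega
      · rfl
    rw [hu g hg, hv g hg]
    rcases Nat.even_or_odd' n with ⟨l, rfl | rfl⟩
    · have hl : 2 * l / 2 = l := by omega
      rw [hl] at hu hv ⊢
      have hfl := hf l (by omega)
      have hsq : coord u l ^ 2 = coord v l ^ 2 := by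
        unfold f at hfl
        split_ifs at hfl with h0
        · subst h0
          rw [eval_x, eval_x] at hfl
          rw [hfl]
        · rw [eval_quad_of_coord_eq_zero fun i hi => hcu i (by omega),
            eval_quad_of_coord_eq_zero fun i hi => hcv i (by omega)] at hfl
          refine mul_left_cancel₀ ?_ hfl
          simp
      rcases Nat.even_or_odd l with hl2 | hl2
      · have h4 : 4 ∣ 2 * l := by
          obtain ⟨p, rfl⟩ := hl2
          exact ⟨p, by ring⟩
        obtain ⟨hwA, hwc⟩ := (isExtraInvariant_iff (even_two_mul l) w).1 (hw h4)
        have h3 := hE w (Or.inr ⟨h4, rfl⟩)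
        rw [hu w hwA, hv w hwA, hwc, hwc] at h3
        -- Equal squares and equal cubes give equal values.
        have h5 : coord u l = coord v l := by
          by_cases h0 : coord v l = 0
          · rw [h0] at hsq ⊢
            simpa using hsq
          · refine mul_right_cancel₀ (pow_ne_zero 2 h0) ?_
            rw [← hsq, ← pow_succ', h3, hsq, ← pow_succ']
        rw [h5]
      · rcases sq_eq_sq_iff_eq_or_eq_neg.1 hsq with h | h
        · rw [h]
        · rw [h, eval_mid_neg hl2 hg]
    -- For odd n there is no coordinate of weight zero: both middle points are the origin.
    · congr 2
      funext i
      simp only [mid]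
      rw [if_neg (by omega), if_neg (by omega)]

/-! ### Degrees -/

theorem IsHomogeneous.degree_eq_of_eq {σ : Type*} {p q : MvPolynomial σ k} {a b : ℕ}
    (hp : p.IsHomogeneous a) (hq : q.IsHomogeneous b) (h : p = q) (h0 : p ≠ 0) : a = b := by
  subst h
  exact hp.inj_right hq h0

theorem isHomogeneous_x (n i : ℕ) : (x k n i).IsHomogeneous 1 := by
  unfold x
  split_ifs
  · exact isHomogeneous_X k _
  · exact isHomogeneous_zero _ k _

theorem isHomogeneous_quad (n m : ℕ) : (quad k n m).IsHomogeneous 2 := by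
  unfold quad
  refine IsHomogeneous.add (IsHomogeneous.sum _ _ _ fun i _ => ?_) ?_
  · rw [neg_one_pow_eq_C]
    exact ((isHomogeneous_x n i).C_mul _).mul (isHomogeneous_x n _)
  · rw [neg_one_pow_eq_C, ← C_mul]
    exact ((isHomogeneous_x n m).pow 2).C_mul _

theorem isHomogeneous_f (n m : ℕ) : (f k n m).IsHomogeneous (if m = 0 then 1 else 2) := by
  unfold f
  split_ifs
  · exact isHomogeneous_x n 0
  · exact isHomogeneous_quad n m

theorem isHomogeneous_s (n m : ℕ) : (s k n m).IsHomogeneous (if m = 0 then 1 else 2) := by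
  unfold s
  split_ifs
  · exact isHomogeneous_x n 1
  · refine IsHomogeneous.sum _ _ _ fun i _ => ?_
    rw [neg_one_pow_eq_C, ← C_mul]
    exact ((isHomogeneous_x n i).C_mul _).mul (isHomogeneous_x n _)

theorem isHomogeneous_eps_x {n j d : ℕ} (hj : j ≤ n) {s : R k n} (hs : s.IsHomogeneous d)
    (hD : (D k n s).IsHomogeneous d) : (eps s (x k n j)).IsHomogeneous (1 + d * j) := by
  rw [eps_x s hj]
  refine IsHomogeneous.sum _ _ _ fun i hi => ?_
  have h := ((((isHomogeneous_x (k := k) n (j - i)).C_mul ((-1) ^ i / (i.factorial : k))).mul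
    (hs.pow i)).mul (hD.pow (j - i)))
  have hi := Nat.lt_succ_iff.1 (Finset.mem_range.1 hi)
  convert h using 1
  rw [add_assoc, ← mul_add, Nat.add_sub_cancel' hi]

theorem isHomogeneous_eps_s [CharZero k] {n m j : ℕ} (hn : 1 ≤ n) (hm : m ≤ (n - 1) / 2)
    (hj : j ≤ n) :
    (eps (s k n m) (x k n j)).IsHomogeneous (1 + (if m = 0 then 1 else 2) * j) :=
  isHomogeneous_eps_x hj (isHomogeneous_s n m) (by rw [D_s hn hm]; exact isHomogeneous_f n m)

theorem isHomogeneous_Delta_iterate {n d : ℕ} {g : R k n} (hg : g.IsHomogeneous d) (i : ℕ) :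
    ((Delta k n)^[i] g).IsHomogeneous d := by
  induction i with
  | zero => exact hg
  | succ i ih =>
    rw [Function.iterate_succ_apply']
    refine isWeightedHomogeneous_derivation (d := 0) (Delta k n) (fun j => ?_) ih
    rw [Delta_X, ← C_mul]
    exact (isHomogeneous_x n _).C_mul _

theorem totalDegree_wInv_le (n : ℕ) : (wInv k n).totalDegree ≤ 3 := by
  have h : (wInv k n).IsHomogeneous 3 := by
    refine IsHomogeneous.C_mul (IsHomogeneous.sum _ _ _ fun i _ => ?_) _
    exact ((isHomogeneous_x n _).C_mul _).mul (isHomogeneous_Delta_iterate (isHomogeneous_quad n _) i)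
  exact h.totalDegree_le

theorem totalDegree_le_of_mem_E [CharZero k] {n : ℕ} (hn : 1 ≤ n) {g : R k n}
    (hg : g ∈ E n (wInv k n)) : g.totalDegree ≤ 2 * n + 1 := by
  rcases hg with ((⟨m, hm, rfl⟩ | ⟨j, hj, hjn, rfl⟩) | ⟨m, j, hm, hmn, hj, hjn, rfl⟩) | ⟨h4, rfl⟩
  · refine (isHomogeneous_f n m).totalDegree_le.trans ?_
    split_ifs <;> omega
  · refine (isHomogeneous_eps_s hn (Nat.zero_le _) hjn).totalDegree_le.trans ?_
    rw [if_pos rfl]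
    omega
  · refine (isHomogeneous_eps_s hn hmn hjn).totalDegree_le.trans ?_
    rw [if_neg (by omega)]
    omega
  · exact (totalDegree_wInv_le n).trans (by omega)

/-! ### The elements of `E_n` are distinct -/

/-- The point with coordinates `x_0 = x_b = 1`, all others being zero. -/
def twoPt (k : Type u) [Field k] (n b : ℕ) : Fin (n + 1) → k :=
  fun i => if (i : ℕ) = 0 ∨ (i : ℕ) = b then 1 else 0

theorem coord_twoPt {n b : ℕ} (hb : b ≤ n) (i : ℕ) :
    coord (twoPt k n b) i = if i = 0 ∨ i = b then 1 else 0 := by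
  unfold coord twoPt
  by_cases h : i < n + 1
  · rw [dif_pos h]
  · rw [dif_neg h, if_neg (by omega)]

theorem eval_twoPt_f {n b m : ℕ} (hb : b ≤ n) (hm : 1 ≤ m) (hmb : m ≠ b) :
    eval (twoPt k n b) (f k n m) = if 2 * m = b then 1 else 0 := by
  rw [f, if_neg (by omega), eval_quad, Finset.sum_eq_single_of_mem 0 (Finset.mem_range.2 hm)]
  · simp only [coord_twoPt hb]
    rw [if_neg (show ¬ (m = 0 ∨ m = b) by omega)]
    simp only [true_or, if_true, Nat.sub_zero, show ¬ (2 * m = 0) by omega, false_or]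
    simp
  · intro i hi hi0
    have hi := Finset.mem_range.1 hi
    simp only [coord_twoPt hb]
    by_cases h : i = b
    · rw [if_neg (show ¬ (2 * m - i = 0 ∨ 2 * m - i = b) by omega), mul_zero]
    · rw [if_neg (show ¬ (i = 0 ∨ i = b) by omega), mul_zero, zero_mul]

theorem eval_twoPt_f_self {n m : ℕ} (hm : 1 ≤ m) (hmn : m ≤ n) :
    eval (twoPt k n m) (f k n m) = 1 / 2 * (-1) ^ m := by
  rw [f, if_neg (by omega), eval_quad, Finset.sum_eq_zero]
  · simp [coord_twoPt hmn]
  · intro i hi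
    have hi := Finset.mem_range.1 hi
    simp only [coord_twoPt hmn]
    rw [if_neg (show ¬ (2 * m - i = 0 ∨ 2 * m - i = m) by omega), mul_zero]

theorem eval_twoPt_s {n b m : ℕ} (hb : b ≤ n) (hm : 1 ≤ m) (hmb : m < b) :
    eval (twoPt k n b) (s k n m) = if 2 * m + 1 = b then (2 * (m : k) + 1) / 2 else 0 := by
  rw [s, if_neg (by omega), map_sum, Finset.sum_eq_single_of_mem 0 (Finset.mem_range.2 (by omega))]
  · simp [coord_twoPt hb]
  · intro i hi hi0
    have hi := Finset.mem_range.1 hi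
    rw [map_mul, map_mul, eval_x, coord_twoPt hb, if_neg (by omega), mul_zero, zero_mul]

theorem eval_eps_x_of_eval_eq_zero {n j : ℕ} (s : R k n) (hj : j ≤ n) {u : Fin (n + 1) → k}
    (hu : eval u s = 0) : eval u (eps s (x k n j)) = coord u j * eval u (D k n s) ^ j := by
  rw [eps_x s hj, map_sum, Finset.sum_eq_single_of_mem 0 (Finset.mem_range.2 (by omega))]
  · simp
  · intro i _ hi
    simp [hu, hi]

/-- The point e_0 + e_{2m+1} detects the index m: there f_{m'} = 0 for 1 ≤ m' ≤ m, while among the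
corresponding s_{m'} only s_m is nonzero. This separates elements of equal degree. -/
theorem eval_twoPt_eps_s_of_lt [CharZero k] {n m m' j : ℕ} (hm : 2 * m + 1 ≤ n) (hm' : 1 ≤ m')
    (h : m' < m) (hj1 : 1 ≤ j) (hj : j ≤ n) :
    eval (twoPt k n (2 * m + 1)) (eps (s k n m') (x k n j)) = 0 := by
  rw [eval_eps_x_of_eval_eq_zero _ hj, D_s (by omega) (by omega),
    eval_twoPt_f hm hm' (by omega), if_neg (by omega), zero_pow (by omega), mul_zero]
  rw [eval_twoPt_s hm hm' (by omega), if_neg (by omega)]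

theorem eval_twoPt_eps_s_ne_zero [CharZero k] {n m j : ℕ} (hm : 2 * m + 1 ≤ n) (hm' : 1 ≤ m)
    (hj : j ≤ n) : eval (twoPt k n (2 * m + 1)) (eps (s k n m) (x k n j)) ≠ 0 := by
  rw [eval_eps_x_of_eval_D_eq_zero _ hj, eval_twoPt_s hm hm' (by omega), if_pos rfl,
    coord_twoPt hm, if_pos (Or.inl rfl)]
  · have h1 : (2 * (m : k) + 1) ≠ 0 := by exact_mod_cast (by omega : 2 * m + 1 ≠ 0)
    have h2 : (j.factorial : k) ≠ 0 := by exact_mod_cast j.factorial_ne_zero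
    simp [h1, h2]
  · rw [D_s (by omega) (by omega), eval_twoPt_f hm hm' (by omega), if_neg (by omega)]

theorem eval_twoPt_eps_s_zero {n b j : ℕ} (hb : b ≤ n) (hb2 : 2 ≤ b) (hj : j ≤ n) :
    eval (twoPt k n b) (eps (s k n 0) (x k n j)) = if j = 0 ∨ j = b then 1 else 0 := by
  have h1 : eval (twoPt k n b) (s k n 0) = 0 := by
    rw [s, if_pos rfl, eval_x, coord_twoPt hb, if_neg (by omega)]
  rw [eval_eps_x_of_eval_eq_zero _ hj h1, s, if_pos rfl, D_x_succ (by omega), eval_x,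
    coord_twoPt hb, coord_twoPt hb]
  simp

theorem eps_s_ne_zero [CharZero k] {n m j : ℕ} (hm : 2 * m + 1 ≤ n) (hj2 : 2 ≤ j ∨ 1 ≤ m)
    (hj : j ≤ n) : eps (s k n m) (x k n j) ≠ 0 := by
  intro h
  rcases Nat.eq_zero_or_pos m with rfl | h0
  · have := eval_twoPt_eps_s_zero (k := k) hj (by omega) hj
    simp [h] at this
  · exact eval_twoPt_eps_s_ne_zero (k := k) hm h0 hj (by rw [h, map_zero])

theorem injOn_f [CharZero k] (n : ℕ) :
    Set.InjOn (f k n) (Finset.range (n / 2 + 1) : Finset ℕ) := by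
  intro a ha b hb hab
  simp only [Finset.coe_range, Set.mem_Iio] at ha hb
  have hdeg := IsHomogeneous.degree_eq_of_eq (isHomogeneous_f (k := k) n a)
    (isHomogeneous_f n b) hab (f_ne_zero (by omega))
  by_contra hne
  have h0 : 1 ≤ a ∧ 1 ≤ b := by
    split_ifs at hdeg <;> omega
  have h1 := congrArg (eval (twoPt k n (2 * a))) hab
  rw [eval_twoPt_f (by omega) h0.1 (by omega), if_pos rfl] at h1
  by_cases h2 : b = 2 * a
  · rw [← h2, eval_twoPt_f_self h0.2 (by omega)] at h1
    -- Exceptional case b = 2a: f_b takes the value ±1/2 where f_a is 1, and squaring gives 4 = 1.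
    have h3 : (2 : k) = (-1) ^ b := by linear_combination 2 * h1
    have h4 := congrArg (· ^ 2) h3
    simp only [← pow_mul, mul_comm b 2] at h4
    rw [pow_mul, neg_one_sq, one_pow] at h4
    norm_num at h4
  · rw [eval_twoPt_f (by omega) h0.2 h2, if_neg (by omega)] at h1
    exact one_ne_zero h1

theorem injOn_eps_s_zero [CharZero k] (n : ℕ) :
    Set.InjOn (fun j => eps (s k n 0) (x k n j)) (Finset.Icc 2 n : Finset ℕ) := by
  intro a ha b hb hab
  simp only [Finset.coe_Icc, Set.mem_Icc] at ha hb
  simp only at hab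
  have hdeg := IsHomogeneous.degree_eq_of_eq
    (isHomogeneous_eps_s (k := k) (by omega) (Nat.zero_le _) ha.2)
    (isHomogeneous_eps_s (by omega) (Nat.zero_le _) hb.2) hab
    (eps_s_ne_zero (by omega) (by omega) ha.2)
  rw [if_pos rfl] at hdeg
  omega

/-- The pairs `(m, j)` indexing the elements `ε_{s_m}(x_j)` of `E_n` with `m ≥ 1`. -/
def pairs (n : ℕ) : Finset (Σ _ : ℕ, ℕ) :=
  (Finset.Icc 1 ((n - 1) / 2)).sigma fun m => Finset.Icc m n

theorem mem_pairs {n : ℕ} {q : Σ _ : ℕ, ℕ} :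
    q ∈ pairs n ↔ (1 ≤ q.1 ∧ q.1 ≤ (n - 1) / 2) ∧ q.1 ≤ q.2 ∧ q.2 ≤ n := by
  simp [pairs]

theorem injOn_eps_s [CharZero k] (n : ℕ) :
    Set.InjOn (fun q : Σ _ : ℕ, ℕ => eps (s k n q.1) (x k n q.2)) (pairs n) := by
  rintro ⟨m, j⟩ hq ⟨m', j'⟩ hq' h
  have ⟨⟨h1, h2⟩, h3, h4⟩ := mem_pairs.1 (Finset.mem_coe.1 hq)
  have ⟨⟨h1', h2'⟩, h3', h4'⟩ := mem_pairs.1 (Finset.mem_coe.1 hq')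
  simp only at h h1 h2 h3 h4 h1' h2' h3' h4'
  have hdeg := IsHomogeneous.degree_eq_of_eq
    (isHomogeneous_eps_s (k := k) (by omega) h2 h4)
    (isHomogeneous_eps_s (by omega) h2' h4') h (eps_s_ne_zero (by omega) (by omega) h4)
  rw [if_neg (by omega), if_neg (by omega)] at hdeg
  obtain rfl : j = j' := by omega
  rcases lt_trichotomy m m' with hlt | rfl | hlt
  · refine absurd ?_ (eval_twoPt_eps_s_ne_zero (k := k) (n := n) (m := m') (j := j)
      (by omega) h1' h4)
    rw [← h, eval_twoPt_eps_s_of_lt (by omega) h1 hlt (by omega) h4]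
  · rfl
  · refine absurd ?_ (eval_twoPt_eps_s_ne_zero (k := k) (n := n) (m := m) (j := j)
      (by omega) h1 h4)
    rw [h, eval_twoPt_eps_s_of_lt (by omega) h1' hlt (by omega) h4]

theorem f_ne_eps_s [CharZero k] {n a m j : ℕ} (ha : a ≤ n / 2) (hm : 2 * m + 1 ≤ n)
    (hj2 : 2 ≤ j ∨ 1 ≤ m) (hj1 : 1 ≤ j) (hj : j ≤ n) : f k n a ≠ eps (s k n m) (x k n j) := by
  intro h
  have hdeg := IsHomogeneous.degree_eq_of_eq (isHomogeneous_f (k := k) n a)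
    (isHomogeneous_eps_s (by omega) (by omega) hj) h (f_ne_zero (by omega))
  split_ifs at hdeg <;> omega

theorem eps_s_zero_ne_eps_s [CharZero k] {n i m j : ℕ} (hi : 2 ≤ i) (hin : i ≤ n) (h1 : 1 ≤ m)
    (hm : 2 * m + 1 ≤ n) (hj : j ≤ n) :
    eps (s k n 0) (x k n i) ≠ eps (s k n m) (x k n j) := by
  intro h
  have hdeg := IsHomogeneous.degree_eq_of_eq
    (isHomogeneous_eps_s (k := k) (by omega) (Nat.zero_le _) hin)
    (isHomogeneous_eps_s (by omega) (by omega) hj) h (eps_s_ne_zero (by omega) (by omega) hin)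
  rw [if_pos rfl, if_neg (by omega)] at hdeg
  refine absurd ?_ (eval_twoPt_eps_s_ne_zero (k := k) (n := n) (m := m) (j := j) hm h1 hj)
  -- The degrees force i = 2j, so i is even and differs from 2m + 1.
  rw [← h, eval_twoPt_eps_s_zero hm (by omega) hin, if_neg (by omega)]

theorem coord_mid_of_lt {n : ℕ} (c : k) {i : ℕ} (hi : 2 * i < n) : coord (mid n c) i = 0 := by
  unfold coord mid
  split_ifs
  · simp only at *
    omega
  · rfl
  · rfl

theorem ne_f_of_isExtraInvariant [CharZero k] {n m : ℕ} (hn : 4 ∣ n) {w : R k n}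
    (hw : IsExtraInvariant w) (hm : m ≤ n / 2) : w ≠ f k n m := by
  obtain ⟨l, rfl⟩ : ∃ l, n = 2 * l := ⟨n / 2, by omega⟩
  have hc := ((isExtraInvariant_iff (even_two_mul l) w).1 hw).2
  rintro rfl
  rcases Nat.eq_zero_or_pos l with rfl | hl
  · obtain rfl : m = 0 := by omega
    -- For n = 0 the two candidates are c³ and c, which agree at c = 1; hence the value 2.
    have := hc 2
    rw [f, if_pos rfl, eval_x, coord_mid, if_pos rfl] at this
    norm_num at this
  · have h1 := hc 1
    rcases Nat.lt_or_ge m l with h | h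
    · rw [eval_f_of_coord_eq_zero fun i hi => coord_mid_of_lt _ (by omega)] at h1
      simp at h1
    · obtain rfl : m = l := by omega
      rw [f, if_neg (by omega), eval_quad_of_coord_eq_zero
        fun i hi => coord_mid_of_lt _ (by omega), coord_mid, if_pos rfl] at h1
      have h3 : (2 : k) = (-1) ^ m := by linear_combination -2 * h1
      have h4 := congrArg (· ^ 2) h3
      simp only [← pow_mul, mul_comm m 2] at h4
      rw [pow_mul, neg_one_sq, one_pow] at h4
      norm_num at h4

theorem ne_eps_s_of_isExtraInvariant [CharZero k] {n m j : ℕ} (hn : 4 ∣ n) {w : R k n}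
    (hw : IsExtraInvariant w) (hm : 2 * m + 1 ≤ n) (hj : j ≤ n) :
    w ≠ eps (s k n m) (x k n j) := by
  rintro rfl
  have hc := ((isExtraInvariant_iff (even_iff_two_dvd.2 (by omega)) _).1 hw).2 1
  rw [eval_eps_x_of_eval_D_eq_zero _ hj, coord_mid_of_lt _ (by omega)] at hc
  · simp at hc
  · rw [D_s (by omega) (by omega)]
    exact eval_f_of_coord_eq_zero fun i hi => coord_mid_of_lt _ (by omega)

theorem E_eq (n : ℕ) (w : R k n) : E n w =
    ((f k n '' (Finset.range (n / 2 + 1) : Finset ℕ) ∪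
      (fun j => eps (s k n 0) (x k n j)) '' (Finset.Icc 2 n : Finset ℕ)) ∪
      (fun q : Σ _ : ℕ, ℕ => eps (s k n q.1) (x k n q.2)) '' (pairs n)) ∪
      (if 4 ∣ n then {w} else ∅) := by
  unfold E
  congr 1
  · congr 1
    · congr 1
      · ext g
        simp only [Set.mem_ofPred_eq, Set.mem_image, Finset.coe_range, Set.mem_Iio, Nat.lt_succ_iff]
        exact ⟨fun ⟨m, h, e⟩ => ⟨m, h, e.symm⟩, fun ⟨m, h, e⟩ => ⟨m, h, e.symm⟩⟩
      · ext g
        simp only [Set.mem_ofPred_eq, Set.mem_image, Finset.coe_Icc, Set.mem_Icc]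
        exact ⟨fun ⟨m, h, h', e⟩ => ⟨m, ⟨h, h'⟩, e.symm⟩, fun ⟨m, ⟨h, h'⟩, e⟩ => ⟨m, h, h', e.symm⟩⟩
    · ext g
      simp only [Set.mem_ofPred_eq, Set.mem_image, Finset.mem_coe, mem_pairs]
      exact ⟨fun ⟨m, j, h1, h2, h3, h4, e⟩ => ⟨⟨m, j⟩, ⟨⟨h1, h2⟩, h3, h4⟩, e.symm⟩,
        fun ⟨⟨m, j⟩, ⟨⟨h1, h2⟩, h3, h4⟩, e⟩ => ⟨m, j, h1, h2, h3, h4, e.symm⟩⟩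
  · ext g
    split_ifs with h <;> simp [h]

theorem finite_E (n : ℕ) (w : R k n) : (E n w).Finite := by
  rw [E_eq]
  refine Set.Finite.union (Set.Finite.union (Set.Finite.union ?_ ?_) ?_) ?_
  · exact (Finset.finite_toSet _).image _
  · exact (Finset.finite_toSet _).image _
  · exact (Finset.finite_toSet _).image _
  · split_ifs
    · exact Set.finite_singleton w
    · exact Set.finite_empty

theorem ncard_E [CharZero k] {n : ℕ} {w : R k n} (hw : 4 ∣ n → IsExtraInvariant w) :
    (E n w).ncard = (n / 2 + 1) + (n - 1) + ∑ m ∈ Finset.Icc 1 ((n - 1) / 2), (n + 1 - m)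
      + (if 4 ∣ n then 1 else 0) := by
  have hfin := finite_E n w
  rw [E_eq] at hfin ⊢
  have hfin1 := hfin.subset Set.subset_union_left
  have hfin2 := hfin1.subset Set.subset_union_left
  rw [Set.ncard_union_eq ?_ hfin1 (hfin.subset Set.subset_union_right),
    Set.ncard_union_eq ?_ hfin2 (hfin1.subset Set.subset_union_right),
    Set.ncard_union_eq ?_ (hfin2.subset Set.subset_union_left)
      (hfin2.subset Set.subset_union_right),
    (injOn_f n).ncard_image, (injOn_eps_s_zero n).ncard_image,
    (injOn_eps_s n).ncard_image, Set.ncard_coe_finset, Set.ncard_coe_finset,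
    Set.ncard_coe_finset, Finset.card_range, Nat.card_Icc, pairs, Finset.card_sigma]
  · simp only [Nat.card_Icc]
    congr 1
    split_ifs <;> simp
  · rw [Set.disjoint_left]
    rintro _ ⟨m, hm, rfl⟩ ⟨j, hj, h⟩
    simp only [Finset.coe_range, Set.mem_Iio] at hm
    simp only [Finset.coe_Icc, Set.mem_Icc] at hj
    exact f_ne_eps_s (by omega) (by omega) (Or.inl hj.1) (by omega) hj.2 h.symm
  · rw [Set.disjoint_left]
    rintro _ (⟨i, hi, rfl⟩ | ⟨i, hi, rfl⟩) ⟨q, hq, h⟩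
    · simp only [Finset.coe_range, Set.mem_Iio] at hi
      have ⟨⟨h1, h2⟩, h3, h4⟩ := mem_pairs.1 (Finset.mem_coe.1 hq)
      exact f_ne_eps_s (by omega) (by omega) (Or.inr h1) (by omega) h4 h.symm
    · simp only [Finset.coe_Icc, Set.mem_Icc] at hi
      have ⟨⟨h1, h2⟩, h3, h4⟩ := mem_pairs.1 (Finset.mem_coe.1 hq)
      exact eps_s_zero_ne_eps_s hi.1 hi.2 h1 (by omega) h4 h.symm
  · rw [Set.disjoint_right]
    intro g hg
    split_ifs at hg with hn
    · obtain rfl : g = w := by simpa using hg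
      rintro ((⟨i, hi, h⟩ | ⟨i, hi, h⟩) | ⟨q, hq, h⟩)
      · simp only [Finset.coe_range, Set.mem_Iio] at hi
        exact ne_f_of_isExtraInvariant hn (hw hn) (by omega) h.symm
      · simp only [Finset.coe_Icc, Set.mem_Icc] at hi
        exact ne_eps_s_of_isExtraInvariant hn (hw hn) (by omega) hi.2 h.symm
      · have ⟨⟨h1, h2⟩, h3, h4⟩ := mem_pairs.1 (Finset.mem_coe.1 hq)
        exact ne_eps_s_of_isExtraInvariant hn (hw hn) (by omega) h4 h.symm
    · simp at hg

/-! ### Asymptotics -/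

/-- With h = ⌊(n-1)/2⌋ the double family contributes h(n+1) - h(h+1)/2; as h is n/2 up to a bounded
error this is n²/2 - n²/8 up to O(n), and the rest is linear in n. -/
theorem abs_ncard_E_sub_le [CharZero k] (n : ℕ) :
    |((E n (wInv k n)).ncard : ℝ) - 3 / 8 * (n : ℝ) ^ 2| ≤ 4 * (n : ℝ) + 4 := by
  rw [ncard_E fun h => isExtraInvariant_wInv h]
  have hsum : ∀ h ≤ n, ((∑ m ∈ Finset.Icc 1 h, (n + 1 - m) : ℕ) : ℝ) =
      h * (n + 1) - h * (h + 1) / 2 := by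
    intro h
    induction h with
    | zero => simp
    | succ h ih =>
      intro hh
      rw [Finset.sum_Icc_succ_top (by omega), Nat.cast_add, ih (by omega),
        Nat.cast_sub (by omega)]
      push_cast
      ring
  have hδ : ((if 4 ∣ n then 1 else 0 : ℕ) : ℝ) ≤ 1 ∧ (0 : ℝ) ≤ ((if 4 ∣ n then 1 else 0 : ℕ) : ℝ) := by
    split_ifs <;> simp
  rw [Nat.cast_add, Nat.cast_add, hsum _ (by omega)]
  set h := (n - 1) / 2 with hh
  have h1 : (2 : ℝ) * h ≤ n := by exact_mod_cast (by omega : 2 * h ≤ n)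
  have h2 : (n : ℝ) ≤ 2 * h + 2 := by exact_mod_cast (by omega : n ≤ 2 * h + 2)
  have h3 : ((n / 2 + 1 + (n - 1) : ℕ) : ℝ) ≤ 3 / 2 * n + 1 := by
    have : (2 : ℝ) * ((n / 2 + 1 + (n - 1) : ℕ) : ℝ) ≤ 3 * n + 2 := by
      exact_mod_cast (by omega : 2 * (n / 2 + 1 + (n - 1)) ≤ 3 * n + 2)
    linarith
  have h4 : (0 : ℝ) ≤ ((n / 2 + 1 + (n - 1) : ℕ) : ℝ) := Nat.cast_nonneg _
  have h5 : (0 : ℝ) ≤ h := Nat.cast_nonneg _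
  have h6 : (0 : ℝ) ≤ n := Nat.cast_nonneg _
  have h7 := mul_nonneg (sub_nonneg.2 h1) h6
  have h8 := mul_nonneg (sub_nonneg.2 h2) h6
  have h9 := mul_nonneg (sub_nonneg.2 h1) (sub_nonneg.2 h2)
  rw [abs_le]
  constructor <;> nlinarith

theorem tendsto_ncard_E [CharZero k] :
    Filter.Tendsto (fun n : ℕ => ((E n (wInv k n)).ncard : ℝ) / (n : ℝ) ^ 2) Filter.atTop
      (nhds (3 / 8)) := by
  rw [tendsto_iff_norm_sub_tendsto_zero]
  refine squeeze_zero' (Filter.Eventually.of_forall fun _ => norm_nonneg _) ?_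
    -- The constant 8 comes from 4n + 4 ≤ 8n for n ≥ 1.
    (tendsto_const_div_atTop_nhds_zero_nat 8)
  filter_upwards [Filter.eventually_ge_atTop 1] with n hn
  have hn' : (1 : ℝ) ≤ n := by exact_mod_cast hn
  have h0 : (0 : ℝ) < (n : ℝ) ^ 2 := by positivity
  have h1 := abs_ncard_E_sub_le (k := k) n
  rw [Real.norm_eq_abs, show ((E n (wInv k n)).ncard : ℝ) / (n : ℝ) ^ 2 - 3 / 8 =
    (((E n (wInv k n)).ncard : ℝ) - 3 / 8 * (n : ℝ) ^ 2) / (n : ℝ) ^ 2 by field_simp, abs_div,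
    abs_of_pos h0, div_le_div_iff₀ h0 (by positivity)]
  nlinarith

end BasicGa

theorem theorem2p1 (k : Type u) [Field k] [CharZero k] :
    -- `A_n = ker D_n` is the algebra of invariants of the basic action
    (∀ (n : ℕ) (g : BasicGa.R k n),
      g ∈ BasicGa.A k n ↔ ∀ a : k, BasicGa.gaAct k n a g = g) ∧
    -- the elements `s_m` are local slices with `D_n s_m = f_m`
    (∀ n m : ℕ, 1 ≤ n → m ≤ (n - 1) / 2 →
      BasicGa.IsLocalSlice (BasicGa.s k n m) ∧
        BasicGa.D k n (BasicGa.s k n m) = BasicGa.f k n m) ∧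
    -- if `4 ∣ n`, the explicit `w` is an invariant with `π_{n/2,n}(w) = x_0^3`
    (∀ n : ℕ, 4 ∣ n → BasicGa.IsExtraInvariant (BasicGa.wInv k n)) ∧
    -- `E_n` is a finite separating set of known size, for any choice of such a `w`
    (∀ (n : ℕ) (w : BasicGa.R k n), (4 ∣ n → BasicGa.IsExtraInvariant w) →
      BasicGa.IsSeparatingSet (BasicGa.E n w) ∧
      (BasicGa.E n w).Finite ∧
      (BasicGa.E n w).ncard =
        (n / 2 + 1) + (n - 1) + ∑ m ∈ Finset.Icc 1 ((n - 1) / 2), (n + 1 - m)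
          + (if 4 ∣ n then 1 else 0)) ∧
    -- the size is asymptotically `3 n^2 / 8`
    Filter.Tendsto
      (fun n : ℕ => ((BasicGa.E n (BasicGa.wInv k n)).ncard : ℝ) / (n : ℝ) ^ 2)
      Filter.atTop (nhds (3 / 8)) ∧
    -- the degrees are at most `2 n + 1`
    (∀ n : ℕ, 1 ≤ n → ∀ g ∈ BasicGa.E n (BasicGa.wInv k n), g.totalDegree ≤ 2 * n + 1) := by
  refine ⟨fun n g => BasicGa.mem_A_iff_forall_gaAct g,
    fun n m hn hm => ⟨BasicGa.isLocalSlice_s hn hm, BasicGa.D_s hn hm⟩,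
    fun n hn => BasicGa.isExtraInvariant_wInv hn,
    fun n w hw => ⟨BasicGa.isSeparatingSet_E hw, BasicGa.finite_E n w, BasicGa.ncard_E hw⟩,
    BasicGa.tendsto_ncard_E, fun n hn g hg => BasicGa.totalDegree_le_of_mem_E hn hg⟩
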